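/- **Setting.** There are $n$ items and $T$ periods, and demand depends on the $M$ previous own prices. Item $i$ has a price ladder $p^i_0<\dots<p^i_{d_i}$, where $p^i_{d_i}$ is the regular price, and unit costs $c^i_t$. Demand is additive: $$d^i_t(x)=\sum_{j\in[n]} f^{ij}_t(x^j_t)+\sum_{k\in[M]}h^i_{tk}(x^i_{t-k}),$$ where the prices $x^i_{t-k}$ with $t-k\le 0$ are given ladder prices. Every $h^i_{tk}$ is non-decreasing on the ladder of item $i$ (post-promotion dip). Items $i\ne j$ are *substitutable* (resp. *complementary*) if for all $t$ both $f^{ij}_t$ and $f^{ji}_t$ are non-decreasing (resp. non-increasing) on the ladders; each pair $i\neq j$ is assumed to be substitutable or complementary, and $S_i$ (resp. $C_i$) is the set of items substitutable (resp. complementary) to $i$. The price promotion problem (PPO) is to maximize $\sum_{i,t}(x^i_t-c^i_t)\,d^i_t(x)$ over $x^i_t\in\{p^i_0,\dots,p^i_{d_i}\}$ subject, if business rules are present, to (with $\iota^i_t=1$ if $x^i_t<p^i_{d_i}$ and $0$ otherwise): $\sum_t\iota^i_t\le L^i$ for all $i$; $\sum_i\iota^i_t\le \bar C_t$ for all $t$;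 $\iota^i_t=\iota^j_t$ for all $t$ and $i,j\in\bar S_t$, where $\bar S_t\subseteq[n]$ is given; $\sum_{t=k}^{k+\tau_i}\iota^i_t\le 1$ for all $i$ and $k\in[T-\tau_i]$. **Formulation.** Let $\Delta^d=\{z\in\mathbb R^d: 1\ge z_1\ge\dots\ge z_d\ge0\}$, with vertices $v_j=e_1+\dots+e_j$, $0\le j\le d$; for a function $g$ on the ladder of $i$ its lift is $z\mapsto g(p^i_0)+\sum_{j}(g(p^i_j)-g(p^i_{j-1}))z_j$. Let $r^i_t,\ell^i_t,\xi^{ij}_t,\zeta^i_{tk}$ be the lifts of $x\mapsto x-c^i_t$, $x\mapsto(x-c^i_t)f^{ii}_t(x)$, $f^{ij}_t$ and $h^i_{tk}$. For $h$ on pairs of vertices of $\Delta^{d_1}\times\Delta^{d_2}$ and $\psi(j_1,j_2)=h(v_{j_1},v_{j_2})$ put $$\mathrm{stair}(h)(z)=\min_\pi\Big\{\psi(j^0)+\sum_{t}(\psi(j^t)-\psi(j^{t-1}))\,z_{\pi_t}\Big\},$$ the minimum being over all monotone unit-step lattice paths $j^0,\dots,j^{d_1+d_2}$ from $(0,0)$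 to $(d_1,d_2)$, where $z_{\pi_t}=z_{a,b}$ if step $t$ is the $b$-th step in direction $a$. Let $\mathrm{rvs\text{-}stair}(h)$ be the same expression with $\psi(j_1,j_2)$ replaced by $h(v_{j_1},v_{d_2-j_2})$ and $z_{2,j}$ replaced by $1-z_{2,d_2+1-j}$. Consider $$\max\ \sum_{i,t}\Big(\ell^i_t(z^i_t)+\sum_{k}\mu^i_{tk}+\sum_{j\ne i}\nu^{ij}_t\Big)$$ subject to $\mu^i_{tk}\le\mathrm{stair}(r^i_t\zeta^i_{tk})(z^i_t,z^i_{t-k})$ for all $i,t,k$; $\nu^{ij}_t\le\mathrm{stair}(r^i_t\xi^{ij}_t)(z^i_t,z^j_t)$ for $j\in S_i$; $\nu^{ij}_t\le\mathrm{rvs\text{-}stair}(r^i_t\xi^{ij}_t)(z^i_t,z^j_t)$ for $j\in C_i$; $x^i_t=p^i_0+\sum_j(p^i_j-p^i_{j-1})z^i_{tj}$ and $z^i_t\in\Delta^{d_i}\cap\{0,1\}^{d_i}$; and, if business rules are present, $\sum_t z^i_{td_i}\ge T-L^i$ for all $i$, $\sum_i z^i_{td_i}\ge n-\bar C_t$ for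 all $t$, $z^i_{td_i}=z^j_{td_j}$ for all $t$ and $i,j\in\bar S_t$, $\sum_{t=k}^{k+\tau_i}z^i_{td_i}\ge\tau_i$ for all $i$ and $k\in[T-\tau_i]$. For $t-k\le0$, $z^i_{t-k}$ denotes the vertex that represents the given price. **Claim.** (1) This is a mixed-integer linear programming formulation of (PPO), with or without business rules: dropping integrality leaves a polyhedron, the objective is linear up to a constant, and the pairs $(x,w)$ for which some feasible $(x,z,\mu,\nu)$ has objective value at least $w$ are exactly the pairs with $x$ feasible for (PPO) and profit at least $w$. (2) If all pairs of distinct items are substitutable and business rules are absent, the LP relaxation (without $z\in\{0,1\}$) solves (PPO), for any numbers $d_i$ of promotion price levels: both optimal values are attained and equal, and the optimal price plans of (PPO) are exactly the $x$-parts of the optimal vertices of the LP relaxation. -/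

import Mathlib

/-! ### Mixed-integer formulations of maximization problems -/

/-- A polyhedron: the solution set of finitely many linear inequalities. -/
def IsPolyhedron {V : Type*} [AddCommGroup V] [Module ℝ V] (Q : Set V) : Prop :=
  ∃ (m : ℕ) (a : Fin m → V →ₗ[ℝ] ℝ) (b : Fin m → ℝ), Q = {v | ∀ k, a k v ≤ b k}

/-- A linear objective function, up to an additive constant. -/
def IsAffineObjective {V : Type*} [AddCommGroup V] [Module ℝ V] (obj : V → ℝ) : Prop :=
  ∃ (a : V →ₗ[ℝ] ℝ) (b : ℝ), ∀ v, obj v = a v + b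

/-- The points of `Q` whose `z`-variables are all binary; the variables are `(x, z, y)`. -/
def binaryPoints {X Y κ : Type*} (Q : Set (X × (κ → ℝ) × Y)) : Set (X × (κ → ℝ) × Y) :=
  {v ∈ Q | ∀ k, v.2.1 k = 0 ∨ v.2.1 k = 1}

/-- The optimal solutions of `max {g s | s ∈ S}`. -/
def maximizers {X : Type*} (S : Set X) (g : X → ℝ) : Set X :=
  {x ∈ S | IsMaxOn g S x}

/-- `max {obj v | v ∈ Q, z binary}` is a mixed-integer linear formulation of `max {g x | x ∈ S}`:
the region `Q` is a polyhedron, the objective is linear, and the hypograph of `g` over `S` is the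
projection onto `(x, value)` of the hypograph of `obj` over the points of `Q` with binary `z`. -/
def IsMIPFormulation {X Y κ : Type*} [AddCommGroup X] [Module ℝ X] [AddCommGroup Y] [Module ℝ Y]
    (S : Set X) (g : X → ℝ) (Q : Set (X × (κ → ℝ) × Y)) (obj : X × (κ → ℝ) × Y → ℝ) : Prop :=
  IsPolyhedron Q ∧ IsAffineObjective obj ∧
    {q : X × ℝ | ∃ v ∈ binaryPoints Q, v.1 = q.1 ∧ q.2 ≤ obj v} =
      {q : X × ℝ | q.1 ∈ S ∧ q.2 ≤ g q.1}

/-- The linear program `max {obj v | v ∈ Q}` solves `max {g x | x ∈ S}`: both optima are attained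
and equal, and the optimal solutions of the problem are exactly the `x`-parts of the optimal
vertices of the linear program. -/
def LPSolves {X Y κ : Type*} [AddCommGroup X] [Module ℝ X] [AddCommGroup Y] [Module ℝ Y]
    (S : Set X) (g : X → ℝ) (Q : Set (X × (κ → ℝ) × Y)) (obj : X × (κ → ℝ) × Y → ℝ) : Prop :=
  IsPolyhedron Q ∧ IsAffineObjective obj ∧
    (∃ w : ℝ, IsGreatest (g '' S) w ∧ IsGreatest (obj '' Q) w) ∧
    maximizers S g = Prod.fst '' (maximizers Q obj ∩ Q.extremePoints ℝ)

/-! ### Unary binarization, lifting, staircases -/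

/-- The unary simplex `1 ≥ z₁ ≥ ⋯ ≥ z_d ≥ 0`. -/
def unarySimplex (d : ℕ) : Set (Fin d → ℝ) :=
  {z | (∀ j, 0 ≤ z j ∧ z j ≤ 1) ∧ Antitone z}

/-- The coordinate `z_j` with `j` counted from `1`, and `z_0 = 1`, `z_{d+1} = 0`. -/
noncomputable def zCoord {d : ℕ} (z : Fin d → ℝ) (j : ℕ) : ℝ :=
  if j = 0 then 1 else if h : j - 1 < d then z ⟨j - 1, h⟩ else 0

/-- The vertex `v_j = e_1 + ⋯ + e_j` of the unary simplex, `0 ≤ j ≤ d`. -/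
noncomputable def unaryVertex (d j : ℕ) : Fin d → ℝ :=
  fun k => if k.val < j then 1 else 0

/-- The affine lift of a univariate function `g` on the ladder `p_0 < ⋯ < p_d`. -/
noncomputable def lift {d : ℕ} (p : Fin (d + 1) → ℝ) (g : ℝ → ℝ) (z : Fin d → ℝ) : ℝ :=
  g (p 0) + ∑ j : Fin d, (g (p j.succ) - g (p j.castSucc)) * z j

/-- The unary binarization polytope of the ladder `p`. -/
def binarization {d : ℕ} (p : Fin (d + 1) → ℝ) : Set (ℝ × (Fin d → ℝ)) :=
  {q | q.1 = p 0 + ∑ j : Fin d, (p j.succ - p j.castSucc) * q.2 j ∧ q.2 ∈ unarySimplex d}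

/-- Staircases from `(0, 0)` to `(d₁, d₂)` in direction representation: at each of the `d₁ + d₂`
moves, the coordinate (`0` or `1`) that is increased. -/
abbrev Staircase (d₁ d₂ : ℕ) : Type :=
  {π : Fin (d₁ + d₂) → Fin 2 //
    (Finset.univ.filter fun s => π s = 0).card = d₁ ∧
    (Finset.univ.filter fun s => π s = 1).card = d₂}

/-- There is at least one staircase, so that minima over staircases are genuine minima. -/
instance (d₁ d₂ : ℕ) : Nonempty (Staircase d₁ d₂) := by
  have h0 : (Finset.univ.filter fun s : Fin (d₁ + d₂) =>
      (if s.val < d₁ then (0 : Fin 2) else 1) = 0).card = d₁ := by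
    rw [Finset.card_filter, Fin.sum_univ_add]
    simp
  have h1 : (Finset.univ.filter fun s : Fin (d₁ + d₂) =>
      (if s.val < d₁ then (0 : Fin 2) else 1) = 1).card = d₂ := by
    rw [Finset.card_filter, Fin.sum_univ_add]
    simp
  exact ⟨⟨fun s => if s.val < d₁ then 0 else 1, h0, h1⟩⟩

/-- The number of moves in direction `a` among the first `t` moves: the point representation of
the staircase is `j^t = (π.steps 0 t, π.steps 1 t)`. -/
def Staircase.steps {d₁ d₂ : ℕ} (π : Staircase d₁ d₂) (a : Fin 2) (t : ℕ) : ℕ :=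
  (Finset.univ.filter fun s : Fin (d₁ + d₂) => s.val < t ∧ π.1 s = a).card

/-- The affine function `ψ(j⁰) + ∑ₜ (ψ(jᵗ) - ψ(jᵗ⁻¹)) z_{πₜ}` of a staircase `π`. -/
noncomputable def stairAffine {d₁ d₂ : ℕ} (ψ : ℕ → ℕ → ℝ) (π : Staircase d₁ d₂)
    (z₁ : Fin d₁ → ℝ) (z₂ : Fin d₂ → ℝ) : ℝ :=
  ψ 0 0 + ∑ s : Fin (d₁ + d₂),
    (ψ (π.steps 0 (s.val + 1)) (π.steps 1 (s.val + 1)) - ψ (π.steps 0 s.val) (π.steps 1 s.val)) *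
      (if π.1 s = 0 then zCoord z₁ (π.steps 0 (s.val + 1))
        else zCoord z₂ (π.steps 1 (s.val + 1)))

/-- The staircase function of `h`: the minimum, over all staircases, of the affine functions of the
grid representation `ψ(j₁, j₂) = h(v_{j₁}, v_{j₂})`. -/
noncomputable def stair {d₁ d₂ : ℕ} (h : (Fin d₁ → ℝ) → (Fin d₂ → ℝ) → ℝ)
    (z₁ : Fin d₁ → ℝ) (z₂ : Fin d₂ → ℝ) : ℝ :=
  ⨅ π : Staircase d₁ d₂,
    stairAffine (fun j₁ j₂ => h (unaryVertex d₁ j₁) (unaryVertex d₂ j₂)) π z₁ z₂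

/-- The map `T`: `λ_j = z_j - z_{j+1}`, `0 ≤ j ≤ d`. -/
noncomputable def toMultipliers {d : ℕ} (z : Fin d → ℝ) : Fin (d + 1) → ℝ :=
  fun j => zCoord z j.val - zCoord z (j.val + 1)

/-- The map `T⁻¹`: `z_j = λ_j + ⋯ + λ_d`, `1 ≤ j ≤ d`. -/
noncomputable def ofMultipliers {d : ℕ} (l : Fin (d + 1) → ℝ) : Fin d → ℝ :=
  fun j => ∑ k : Fin (d + 1) with j.castSucc < k, l k

/-- The inverse of the affine map `T⁻¹ ∘ P^σ ∘ T`, which sends the vertex `v_j` to `v_{σ j}`. -/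
noncomputable def switchInv {d : ℕ} (σ : Equiv.Perm (Fin (d + 1))) (z : Fin d → ℝ) : Fin d → ℝ :=
  ofMultipliers fun k => toMultipliers z (σ k)

/-- The reverse staircase function of `h`: the staircase function for the identity order on the
first and the reversed order on the second argument. -/
noncomputable def rvsStair {d₁ d₂ : ℕ} (h : (Fin d₁ → ℝ) → (Fin d₂ → ℝ) → ℝ)
    (z₁ : Fin d₁ → ℝ) (z₂ : Fin d₂ → ℝ) : ℝ :=
  ⨅ π : Staircase d₁ d₂,
    stairAffine (fun j₁ j₂ => h (unaryVertex d₁ j₁) (unaryVertex d₂ (d₂ - j₂))) π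
      z₁ (switchInv Fin.revPerm z₂)

/-! ### Price promotion optimization with additive demand -/

/-- Data of the problem for `n` items, `T` periods and `M` periods of memory. Periods and lags are
counted from `0`: the lag `k : Fin M` refers to `k + 1` periods earlier. -/
structure PromotionModel (n T M : ℕ) where
  /-- number of promotion prices of an item -/
  d : Fin n → ℕ
  /-- price ladder of an item; the last price is the regular one -/
  p : (i : Fin n) → Fin (d i + 1) → ℝ
  p_strictMono : ∀ i, StrictMono (p i)
  /-- unit cost -/
  c : Fin n → Fin T → ℝ
  /-- effect `f i j t` of the price of item `j` at time `t` on the demand of item `i` -/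
  f : Fin n → Fin n → Fin T → ℝ → ℝ
  /-- effect `h i t k` of the price of item `i`, `k + 1` periods earlier, on its demand at `t` -/
  h : Fin n → Fin T → Fin M → ℝ → ℝ
  /-- index of the given price of item `i` charged `s + 1` periods before the first period -/
  hist : (i : Fin n) → ℕ → Fin (d i + 1)

/-- Business rules: limits `L` on the promotions of an item and `C` on those in a period, sets `S`
of items to be promoted together, and separation times `τ` between promotions of an item. -/
structure BusinessRules (n T : ℕ) where
  L : Fin n → ℕ
  C : Fin T → ℕ
  S : Fin T → Set (Fin n)
  τ : Fin n → ℕ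

namespace PromotionModel

variable {n T M : ℕ} (D : PromotionModel n T M)

/-- Price decisions `x i t`. -/
abbrev Prices (n T : ℕ) : Type := Fin n → Fin T → ℝ

/-- The price of item `i`, `k + 1` periods before `t`. -/
noncomputable def pastPrice (x : Prices n T) (i : Fin n) (t : Fin T) (k : Fin M) : ℝ :=
  if k.val + 1 ≤ t.val then x i ⟨t.val - (k.val + 1), by omega⟩
    else D.p i (D.hist i (k.val - t.val))

/-- Additive demand. -/
noncomputable def demand (x : Prices n T) (i : Fin n) (t : Fin T) : ℝ :=
  ∑ j, D.f i j t (x j t) + ∑ k, D.h i t k (D.pastPrice x i t k)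

/-- Total profit. -/
noncomputable def profit (x : Prices n T) : ℝ :=
  ∑ i, ∑ t, (x i t - D.c i t) * D.demand x i t

open Classical in
/-- Indicator of a promotion of item `i` at time `t`. -/
noncomputable def promoted (x : Prices n T) (i : Fin n) (t : Fin T) : ℕ :=
  if x i t < D.p i (Fin.last (D.d i)) then 1 else 0

/-- The business rules for a price plan. -/
def SatisfiesRules (B : BusinessRules n T) (x : Prices n T) : Prop :=
  (∀ i, ∑ t, D.promoted x i t ≤ B.L i) ∧
  (∀ t, ∑ i, D.promoted x i t ≤ B.C t) ∧
  (∀ t, ∀ i ∈ B.S t, ∀ j ∈ B.S t, D.promoted x i t = D.promoted x j t) ∧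
  (∀ i, ∀ k : ℕ, k + B.τ i < T →
    ∑ t : Fin T with k ≤ t.val ∧ t.val ≤ k + B.τ i, D.promoted x i t ≤ 1)

/-- The feasible price plans; `none` means that business rules are absent. -/
def feasible (rules : Option (BusinessRules n T)) : Set (Prices n T) :=
  {x | (∀ i t, x i t ∈ Set.range (D.p i)) ∧ ∀ B ∈ rules, D.SatisfiesRules B x}

/-- Post-promotion dip effect: cross-period effects are non-decreasing on the price ladder. -/
def PostPromotionDip : Prop :=
  ∀ i t k, MonotoneOn (D.h i t k) (Set.range (D.p i))

/-- Items `i` and `j` are substitutable: the cross-item effects are non-decreasing. -/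
def Substitutable (i j : Fin n) : Prop :=
  ∀ t, MonotoneOn (D.f i j t) (Set.range (D.p j)) ∧ MonotoneOn (D.f j i t) (Set.range (D.p i))

/-- Items `i` and `j` are complementary: the cross-item effects are non-increasing. -/
def Complementary (i j : Fin n) : Prop :=
  ∀ t, AntitoneOn (D.f i j t) (Set.range (D.p j)) ∧ AntitoneOn (D.f j i t) (Set.range (D.p i))

/-- Lift of the unit margin `x - c`. -/
noncomputable def r (i : Fin n) (t : Fin T) : (Fin (D.d i) → ℝ) → ℝ :=
  lift (D.p i) fun y => y - D.c i t

/-- Lift of the self effect `(x - c) f(x)` on profit. -/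
noncomputable def ell (i : Fin n) (t : Fin T) : (Fin (D.d i) → ℝ) → ℝ :=
  lift (D.p i) fun y => (y - D.c i t) * D.f i i t y

/-- Lift of the cross-item effect. -/
noncomputable def xi (i j : Fin n) (t : Fin T) : (Fin (D.d j) → ℝ) → ℝ :=
  lift (D.p j) (D.f i j t)

/-- Lift of the cross-period effect. -/
noncomputable def zeta (i : Fin n) (t : Fin T) (k : Fin M) : (Fin (D.d i) → ℝ) → ℝ :=
  lift (D.p i) (D.h i t k)

/-- Index set of the binary variables `z^i_{tj}`. -/
abbrev BinIdx : Type := (i : Fin n) × (Fin T × Fin (D.d i))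

/-- The continuous variables `μ^i_{tk}` and `ν^{ij}_t`, `j ≠ i`. -/
abbrev Aux (n T M : ℕ) : Type :=
  (Fin n → Fin T → Fin M → ℝ) × ((i : Fin n) → {j : Fin n // j ≠ i} → Fin T → ℝ)

/-- The variables `(x, z, (μ, ν))` of the formulation. -/
abbrev Vars : Type := Prices n T × (D.BinIdx → ℝ) × Aux n T M

/-- The vector `z^i_t`. -/
def zVec (z : D.BinIdx → ℝ) (i : Fin n) (t : Fin T) : Fin (D.d i) → ℝ :=
  fun j => z ⟨i, t, j⟩

/-- The vector `z^i_{t-(k+1)}`; before the horizon it is the vertex of the given past price. -/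
noncomputable def zPast (z : D.BinIdx → ℝ) (i : Fin n) (t : Fin T) (k : Fin M) :
    Fin (D.d i) → ℝ :=
  if k.val + 1 ≤ t.val then D.zVec z i ⟨t.val - (k.val + 1), by omega⟩
    else unaryVertex (D.d i) (D.hist i (k.val - t.val)).val

/-- The coordinate `z^i_{t d_i}`, which is `1` at the regular price and `0` at promotion prices. -/
noncomputable def zLast (z : D.BinIdx → ℝ) (i : Fin n) (t : Fin T) : ℝ :=
  zCoord (D.zVec z i t) (D.d i)

/-- The business rules as linear constraints in `z`. -/
def SatisfiesLinearRules (B : BusinessRules n T) (z : D.BinIdx → ℝ) : Prop :=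
  (∀ i, (T : ℝ) - B.L i ≤ ∑ t, D.zLast z i t) ∧
  (∀ t, (n : ℝ) - B.C t ≤ ∑ i, D.zLast z i t) ∧
  (∀ t, ∀ i ∈ B.S t, ∀ j ∈ B.S t, D.zLast z i t = D.zLast z j t) ∧
  (∀ i, ∀ k : ℕ, k + B.τ i < T →
    (B.τ i : ℝ) ≤ ∑ t : Fin T with k ≤ t.val ∧ t.val ≤ k + B.τ i, D.zLast z i t)

/-- The feasible region of the linear programming relaxation. -/
def lpRegion (rules : Option (BusinessRules n T)) : Set D.Vars :=
  {v | let x := v.1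
       let z := v.2.1
       let μ := v.2.2.1
       let ν := v.2.2.2
       (∀ i t k, μ i t k ≤
         stair (fun y₁ y₂ => D.r i t y₁ * D.zeta i t k y₂) (D.zVec z i t) (D.zPast z i t k)) ∧
       (∀ i t, ∀ j : {j : Fin n // j ≠ i}, D.Substitutable i j → ν i j t ≤
         stair (fun y₁ y₂ => D.r i t y₁ * D.xi i j t y₂) (D.zVec z i t) (D.zVec z j t)) ∧
       (∀ i t, ∀ j : {j : Fin n // j ≠ i}, D.Complementary i j → ν i j t ≤
         rvsStair (fun y₁ y₂ => D.r i t y₁ * D.xi i j t y₂) (D.zVec z i t) (D.zVec z j t)) ∧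
       (∀ i t, (x i t, D.zVec z i t) ∈ binarization (D.p i)) ∧
       ∀ B ∈ rules, D.SatisfiesLinearRules B z}

/-- The linear objective of the formulation. -/
noncomputable def objective (v : D.Vars) : ℝ :=
  ∑ i, ∑ t, (D.ell i t (D.zVec v.2.1 i t) + ∑ k, v.2.2.1 i t k +
    ∑ j : {j : Fin n // j ≠ i}, v.2.2.2 i j t)

end PromotionModel

/-! ### Affine functions and polyhedra -/

section Polyhedra

variable {V : Type*} [AddCommGroup V] [Module ℝ V]

/-! At pairs of vertices the staircase functions are exact. A product of two nondecreasing factors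
is supermodular on the grid. For a supermodular grid function every staircase gives an affine upper
bound at grid points (`Staircase.le_stairAffine`), which is tight along that staircase
(`Staircase.stairAffine_steps`). For complementary items, reversing the second ladder makes the
second factor nondecreasing. So for binary `z` the best `μ`, `ν` reproduce the profit of a price
plan (`le_planPoint`, `objective_planPoint`), and the linear rules say the same as the business
rules, because the last coordinate is one minus the promotion indicator. This gives the
mixed-integer claim.

For the relaxation, round all `z`-vectors with one common random threshold `θ`, replacing each by
the vertex that marks its coordinates at least `θ`. The average of these vertices is `z`
(`exists_random_threshold`). For any two vectors, one staircase, which takes the coordinates in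
decreasing order, passes through all pairs of cuts (`exists_staircase_through_cuts`). Its affine
function at the pair is therefore the average of the grid values, and the staircase function is at
most that average (`stair_le_sum_cut`). Since the threshold is shared by all items and periods, this
handles all terms at once: in the substitutable case each point of the relaxation is dominated by a
convex combination of plan points (`exists_mem_convexHull_planPoint`). Hence the optima agree. An
optimal vertex coincides with its dominating combination, so by extremality it is a plan point;
conversely every plan point is a vertex. -/

theorem IsAffineObjective.const (c : ℝ) : IsAffineObjective fun _ : V => c :=
  ⟨0, c, fun _ => by simp⟩

theorem IsAffineObjective.of_isLinearMap {f : V → ℝ} (hf : IsLinearMap ℝ f) :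
    IsAffineObjective f :=
  ⟨hf.mk', 0, fun _ => by simp⟩

theorem IsAffineObjective.add {f g : V → ℝ} (hf : IsAffineObjective f)
    (hg : IsAffineObjective g) : IsAffineObjective fun v => f v + g v := by
  obtain ⟨a, b, h⟩ := hf
  obtain ⟨a', b', h'⟩ := hg
  exact ⟨a + a', b + b', fun v => by simp only [h, h', LinearMap.add_apply]; ring⟩

theorem IsAffineObjective.mul_const {f : V → ℝ} (hf : IsAffineObjective f) (c : ℝ) :
    IsAffineObjective fun v => f v * c := by
  obtain ⟨a, b, h⟩ := hf
  exact ⟨c • a, b * c, fun v => by simp only [h, LinearMap.smul_apply, smul_eq_mul]; ring⟩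

theorem IsAffineObjective.const_mul {f : V → ℝ} (hf : IsAffineObjective f) (c : ℝ) :
    IsAffineObjective fun v => c * f v := by
  simpa only [mul_comm] using hf.mul_const c

theorem IsAffineObjective.sub {f g : V → ℝ} (hf : IsAffineObjective f)
    (hg : IsAffineObjective g) : IsAffineObjective fun v => f v - g v := by
  simpa only [neg_one_mul, sub_eq_add_neg] using hf.add (hg.const_mul (-1))

theorem IsAffineObjective.sum {ι : Type*} (s : Finset ι) {f : ι → V → ℝ}
    (hf : ∀ i, IsAffineObjective (f i)) : IsAffineObjective fun v => ∑ i ∈ s, f i v := by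
  classical
  induction s using Finset.induction_on with
  | empty => simpa using IsAffineObjective.const 0
  | insert i s hi ih => simpa only [Finset.sum_insert hi] using (hf i).add ih

theorem IsAffineObjective.map_sum {f : V → ℝ} (hf : IsAffineObjective f) {ι : Type*}
    (s : Finset ι) (w : ι → ℝ) (hw : ∑ i ∈ s, w i = 1) (v : ι → V) :
    f (∑ i ∈ s, w i • v i) = ∑ i ∈ s, w i * f (v i) := by
  obtain ⟨a, b, h⟩ := hf
  simp only [h, _root_.map_sum, map_smul, smul_eq_mul, mul_add, Finset.sum_add_distrib,
    ← Finset.sum_mul, hw, one_mul]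

theorem IsPolyhedron.of_finite {κ : Type*} [Finite κ] (a : κ → V →ₗ[ℝ] ℝ) (b : κ → ℝ) :
    IsPolyhedron {v | ∀ k, a k v ≤ b k} := by
  cases nonempty_fintype κ
  refine ⟨Fintype.card κ, fun k => a ((Fintype.equivFin κ).symm k),
    fun k => b ((Fintype.equivFin κ).symm k), Set.ext fun v => ?_⟩
  exact ((Fintype.equivFin κ).symm.forall_congr_right
    (q := fun k => a k v ≤ b k)).symm

theorem IsPolyhedron.forall {ι : Type*} [Finite ι] {P : ι → V → Prop}
    (h : ∀ i, IsPolyhedron {v | P i v}) : IsPolyhedron {v | ∀ i, P i v} := by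
  choose m a b hab using h
  convert IsPolyhedron.of_finite (κ := (i : ι) × Fin (m i)) (fun k => a k.1 k.2)
    (fun k => b k.1 k.2) using 1
  ext v
  have key (i : ι) : P i v ↔ ∀ k, a i k v ≤ b i k := Set.ext_iff.1 (hab i) v
  simp [key, Sigma.forall]

theorem IsPolyhedron.and {P Q : V → Prop} (hP : IsPolyhedron {v | P v})
    (hQ : IsPolyhedron {v | Q v}) : IsPolyhedron {v | P v ∧ Q v} := by
  convert IsPolyhedron.forall (ι := Bool) (P := fun i v => cond i (P v) (Q v)) ?_ using 1
  · ext v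
    simp [and_comm]
  · rintro (_ | _) <;> assumption

theorem IsPolyhedron.true : IsPolyhedron {_v : V | True} :=
  ⟨0, 0, 0, by simp⟩

theorem IsPolyhedron.imp {p : Prop} {P : V → Prop} (h : p → IsPolyhedron {v | P v}) :
    IsPolyhedron {v | p → P v} := by
  by_cases hp : p
  · simpa [hp] using h hp
  · simpa [hp] using IsPolyhedron.true

theorem IsAffineObjective.isPolyhedron_le {f g : V → ℝ} (hf : IsAffineObjective f)
    (hg : IsAffineObjective g) : IsPolyhedron {v | f v ≤ g v} := by
  obtain ⟨a, b, h⟩ := hf.sub hg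
  refine ⟨1, fun _ => a, fun _ => -b, Set.ext fun v => ?_⟩
  have := h v
  simp only [Set.mem_ofPred_eq, forall_const]
  constructor <;> intro <;> linarith

theorem IsAffineObjective.isPolyhedron_eq {f g : V → ℝ} (hf : IsAffineObjective f)
    (hg : IsAffineObjective g) : IsPolyhedron {v | f v = g v} := by
  simpa only [le_antisymm_iff] using (hf.isPolyhedron_le hg).and (hg.isPolyhedron_le hf)

theorem isAffineObjective_zCoord {d : ℕ} {z : V → Fin d → ℝ}
    (hz : ∀ j, IsAffineObjective fun v => z v j) (j : ℕ) :
    IsAffineObjective fun v => zCoord (z v) j := by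
  unfold zCoord
  split_ifs
  · exact .const 1
  · exact hz _
  · exact .const 0

theorem isAffineObjective_lift {d : ℕ} (p : Fin (d + 1) → ℝ) (g : ℝ → ℝ) {z : V → Fin d → ℝ}
    (hz : ∀ j, IsAffineObjective fun v => z v j) :
    IsAffineObjective fun v => lift p g (z v) :=
  (IsAffineObjective.const _).add <| .sum _ fun j => (hz j).const_mul _

theorem isAffineObjective_stairAffine {d₁ d₂ : ℕ} (ψ : ℕ → ℕ → ℝ) (π : Staircase d₁ d₂)
    {z₁ : V → Fin d₁ → ℝ} {z₂ : V → Fin d₂ → ℝ}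
    (h₁ : ∀ j, IsAffineObjective fun v => z₁ v j) (h₂ : ∀ j, IsAffineObjective fun v => z₂ v j) :
    IsAffineObjective fun v => stairAffine ψ π (z₁ v) (z₂ v) := by
  refine (IsAffineObjective.const _).add <| .sum _ fun s => .const_mul ?_ _
  split_ifs
  · exact isAffineObjective_zCoord h₁ _
  · exact isAffineObjective_zCoord h₂ _

theorem isAffineObjective_switchInv {d : ℕ} (σ : Equiv.Perm (Fin (d + 1))) {z : V → Fin d → ℝ}
    (hz : ∀ j, IsAffineObjective fun v => z v j) (j : Fin d) :
    IsAffineObjective fun v => switchInv σ (z v) j := by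
  unfold switchInv ofMultipliers toMultipliers
  exact .sum _ fun _ => (isAffineObjective_zCoord hz _).sub (isAffineObjective_zCoord hz _)

/-- There are finitely many staircases and at least one, so the infimum is a true minimum and a
bound by it amounts to finitely many linear inequalities. -/
theorem le_iInf_stairAffine_iff {d₁ d₂ : ℕ} {ψ : ℕ → ℕ → ℝ} {z₁ : Fin d₁ → ℝ} {z₂ : Fin d₂ → ℝ}
    {y : ℝ} : y ≤ ⨅ π : Staircase d₁ d₂, stairAffine ψ π z₁ z₂ ↔
      ∀ π : Staircase d₁ d₂, y ≤ stairAffine ψ π z₁ z₂ :=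
  le_ciInf_iff (Set.finite_range _).bddBelow

theorem isPolyhedron_le_stair {d₁ d₂ : ℕ} (h : (Fin d₁ → ℝ) → (Fin d₂ → ℝ) → ℝ)
    {f : V → ℝ} {z₁ : V → Fin d₁ → ℝ} {z₂ : V → Fin d₂ → ℝ} (hf : IsAffineObjective f)
    (h₁ : ∀ j, IsAffineObjective fun v => z₁ v j) (h₂ : ∀ j, IsAffineObjective fun v => z₂ v j) :
    IsPolyhedron {v | f v ≤ stair h (z₁ v) (z₂ v)} := by
  simp only [stair, le_iInf_stairAffine_iff]
  exact .forall fun π => hf.isPolyhedron_le (isAffineObjective_stairAffine _ π h₁ h₂)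

theorem isPolyhedron_le_rvsStair {d₁ d₂ : ℕ} (h : (Fin d₁ → ℝ) → (Fin d₂ → ℝ) → ℝ)
    {f : V → ℝ} {z₁ : V → Fin d₁ → ℝ} {z₂ : V → Fin d₂ → ℝ} (hf : IsAffineObjective f)
    (h₁ : ∀ j, IsAffineObjective fun v => z₁ v j) (h₂ : ∀ j, IsAffineObjective fun v => z₂ v j) :
    IsPolyhedron {v | f v ≤ rvsStair h (z₁ v) (z₂ v)} := by
  simp only [rvsStair, le_iInf_stairAffine_iff]
  exact .forall fun π => hf.isPolyhedron_le
    (isAffineObjective_stairAffine _ π h₁ (isAffineObjective_switchInv _ h₂))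

theorem isPolyhedron_mem_unarySimplex {d : ℕ} {z : V → Fin d → ℝ}
    (hz : ∀ j, IsAffineObjective fun v => z v j) : IsPolyhedron {v | z v ∈ unarySimplex d} :=
  .and (.forall fun j => ((IsAffineObjective.const 0).isPolyhedron_le (hz j)).and
      ((hz j).isPolyhedron_le (.const 1)))
    (.forall fun i => .forall fun j => .imp fun _ => (hz j).isPolyhedron_le (hz i))

end Polyhedra

/-! ### Vertices of the unary simplex and thresholds -/

/-- The number of coordinates of `z` that are at least `θ`. -/
noncomputable def cut {d : ℕ} (θ : ℝ) (z : Fin d → ℝ) : ℕ :=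
  (Finset.univ.filter fun k => θ ≤ z k).card

theorem cut_le {d : ℕ} (θ : ℝ) (z : Fin d → ℝ) : cut θ z ≤ d :=
  (Finset.card_le_univ _).trans_eq (Fintype.card_fin d)

/-- For antitone `z` the set where `θ ≤ z` is an initial segment, so its cardinality marks where it
ends. -/
theorem lt_cut_iff {d : ℕ} {z : Fin d → ℝ} (hz : Antitone z) (θ : ℝ) (k : Fin d) :
    k.val < cut θ z ↔ θ ≤ z k := by
  constructor
  · intro hk
    by_contra hθ
    have : (Finset.univ.filter fun l => θ ≤ z l) ⊆ Finset.Iio k := fun l hl => by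
      rw [Finset.mem_Iio]
      by_contra! hkl
      exact hθ ((Finset.mem_filter.1 hl).2.trans (hz hkl))
    have := Finset.card_le_card this
    rw [Fin.card_Iio] at this
    exact (this.trans_lt hk).false
  · intro hθ
    have : Finset.Iic k ⊆ Finset.univ.filter fun l => θ ≤ z l := fun l hl =>
      Finset.mem_filter.2 ⟨Finset.mem_univ _, hθ.trans (hz (Finset.mem_Iic.1 hl))⟩
    have := Finset.card_le_card this
    rw [Fin.card_Iic] at this
    exact this

theorem unaryVertex_cut {d : ℕ} {z : Fin d → ℝ} (hz : Antitone z) (θ : ℝ) (k : Fin d) :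
    unaryVertex d (cut θ z) k = if θ ≤ z k then 1 else 0 := by
  simp only [unaryVertex, lt_cut_iff hz]

theorem unaryVertex_mem (d j : ℕ) : unaryVertex d j ∈ unarySimplex d := by
  refine ⟨fun k => ?_, fun k l hkl => ?_⟩
  · unfold unaryVertex
    split_ifs <;> simp
  · have : k.val ≤ l.val := hkl
    simp only [unaryVertex]
    split_ifs <;> first | omega | simp

theorem cut_unaryVertex {d j : ℕ} (hj : j ≤ d) {θ : ℝ} (h0 : 0 < θ) (h1 : θ ≤ 1) :
    cut θ (unaryVertex d j) = j := by
  have (k : Fin d) : θ ≤ unaryVertex d j k ↔ k.val < j := by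
    unfold unaryVertex
    split_ifs with h <;> simp [h, h0, h1]
  simp only [cut, this]
  rw [Fin.card_filter_val_lt, min_eq_right hj]

theorem lift_unaryVertex {d : ℕ} (p : Fin (d + 1) → ℝ) (g : ℝ → ℝ) (j : Fin (d + 1)) :
    lift p g (unaryVertex d j) = g (p j) := by
  unfold lift unaryVertex
  induction j using Fin.induction with
  | zero => simp
  | succ j ih =>
    have (k : Fin d) : (if k.val < j.succ.val then (1 : ℝ) else 0) =
        (if k.val < j.castSucc.val then 1 else 0) + if k = j then 1 else 0 := by
      simp only [Fin.val_succ, Fin.val_castSucc, Fin.ext_iff]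
      split_ifs <;> first | omega | simp
    simp only [this, mul_add, Finset.sum_add_distrib]
    rw [← add_assoc, ih]
    simp

theorem unaryVertex_min (d j : ℕ) : unaryVertex d (min j d) = unaryVertex d j := by
  funext k
  simp [unaryVertex]

/-- Positions beyond `d` saturate, so grid functions are defined and monotone on all of `ℕ`, with no
range conditions in the supermodularity arguments. -/
theorem lift_unaryVertex_nat {d : ℕ} (p : Fin (d + 1) → ℝ) (g : ℝ → ℝ) (j : ℕ) :
    lift p g (unaryVertex d j) = g (p ⟨min j d, by omega⟩) := by
  rw [← lift_unaryVertex p g, ← unaryVertex_min]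

theorem monotone_lift_unaryVertex {d : ℕ} {p : Fin (d + 1) → ℝ} (hp : StrictMono p) {g : ℝ → ℝ}
    (hg : MonotoneOn g (Set.range p)) : Monotone fun j => lift p g (unaryVertex d j) := by
  intro a b hab
  simp only [lift_unaryVertex_nat]
  exact hg ⟨_, rfl⟩ ⟨_, rfl⟩ (hp.monotone (Fin.mk_le_mk.2 (by omega)))

theorem antitone_lift_unaryVertex {d : ℕ} {p : Fin (d + 1) → ℝ} (hp : StrictMono p) {g : ℝ → ℝ}
    (hg : AntitoneOn g (Set.range p)) : Antitone fun j => lift p g (unaryVertex d j) := by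
  intro a b hab
  simp only [lift_unaryVertex_nat]
  exact hg ⟨_, rfl⟩ ⟨_, rfl⟩ (hp.monotone (Fin.mk_le_mk.2 (by omega)))

theorem zCoord_unaryVertex {d j m : ℕ} (hj : j ≤ d) :
    zCoord (unaryVertex d j) m = if m ≤ j then 1 else 0 := by
  rcases m with - | m
  · simp [zCoord]
  · simp only [zCoord, unaryVertex, Nat.succ_ne_zero, if_false, Nat.add_sub_cancel]
    split_ifs <;> first | omega | rfl

/-- The multipliers of a vertex are a unit mass at its index; reversal moves the mass, and tail sums
turn it back into a vertex. -/
theorem switchInv_rev_unaryVertex {d j : ℕ} (hj : j ≤ d) :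
    switchInv Fin.revPerm (unaryVertex d j) = unaryVertex d (d - j) := by
  funext k
  have (m : Fin (d + 1)) : toMultipliers (unaryVertex d j) (Fin.revPerm m) =
      if m = ⟨d - j, by omega⟩ then 1 else 0 := by
    have := m.isLt
    simp only [toMultipliers, zCoord_unaryVertex hj, Fin.revPerm_apply, Fin.val_rev, Fin.ext_iff]
    split_ifs <;> first | omega | simp
  simp only [switchInv, ofMultipliers, this, Finset.sum_ite_eq', Finset.mem_filter,
    Finset.mem_univ, true_and, unaryVertex, Fin.lt_def, Fin.val_castSucc]

/-- A finite set of numbers in `[0, 1]` is represented by a common finite random threshold. -/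
theorem exists_threshold_weights (s : Finset ℝ) (hs : ∀ y ∈ s, 0 < y) :
    ∃ w : ℝ → ℝ, (∀ θ ∈ s, 0 ≤ w θ) ∧
      (∀ y ∈ s, ∑ θ ∈ s, w θ * (if θ ≤ y then 1 else 0) = y) := by
  induction s using Finset.induction_on_max with
  | empty => exact ⟨0, by simp⟩
  | insert a s ha ih =>
    obtain ⟨w, hw, h⟩ := ih fun y hy => hs y (Finset.mem_insert_of_mem hy)
    have has : a ∉ s := fun h => (ha a h).false
    -- At the largest old value all indicators are one, so its equation gives the total weight. The
    -- new maximum `a` receives the remaining weight and leaves the old equations untouched.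
    have hle : ∑ θ ∈ s, w θ ≤ a := by
      rcases s.eq_empty_or_nonempty with rfl | hne
      · simpa using (hs a (by simp)).le
      · have := h _ (s.max'_mem hne)
        rw [Finset.sum_congr rfl fun θ hθ => by rw [if_pos (s.le_max' θ hθ), mul_one]] at this
        exact this.trans_le (ha _ (s.max'_mem hne)).le
    have hw' : ∀ θ ∈ s, Function.update w a (a - ∑ θ ∈ s, w θ) θ = w θ := fun θ hθ =>
      Function.update_of_ne (ne_of_mem_of_not_mem hθ has) _ _
    refine ⟨Function.update w a (a - ∑ θ ∈ s, w θ), ?_, ?_⟩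
    · rw [Finset.forall_mem_insert]
      refine ⟨by simpa using hle, fun θ hθ => ?_⟩
      rw [hw' θ hθ]
      exact hw θ hθ
    · have key (y : ℝ) : ∑ θ ∈ insert a s, Function.update w a (a - ∑ θ ∈ s, w θ) θ *
          (if θ ≤ y then 1 else 0) = (a - ∑ θ ∈ s, w θ) * (if a ≤ y then 1 else 0) +
            ∑ θ ∈ s, w θ * (if θ ≤ y then 1 else 0) := by
        rw [Finset.sum_insert has, Function.update_self]
        exact congrArg _ (Finset.sum_congr rfl fun θ hθ => by rw [hw' θ hθ])
      rw [Finset.forall_mem_insert]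
      refine ⟨?_, fun y hy => ?_⟩
      · have : ∑ θ ∈ s, w θ * (if θ ≤ a then 1 else 0) = ∑ θ ∈ s, w θ :=
          Finset.sum_congr rfl fun θ hθ => by rw [if_pos (ha θ hθ).le, mul_one]
        rw [key, if_pos le_rfl, this]
        ring
      · rw [key, if_neg (ha y hy).not_ge, h y hy]
        ring

theorem exists_random_threshold {κ : Type*} [Finite κ] (z : κ → ℝ)
    (hz : ∀ k, 0 ≤ z k ∧ z k ≤ 1) :
    ∃ (s : Finset ℝ) (w : ℝ → ℝ), (∀ θ ∈ s, 0 < θ ∧ θ ≤ 1) ∧ (∀ θ ∈ s, 0 ≤ w θ) ∧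
      ∑ θ ∈ s, w θ = 1 ∧ ∀ k, ∑ θ ∈ s, w θ * (if θ ≤ z k then 1 else 0) = z k := by
  classical
  cases nonempty_fintype κ
  -- The threshold `1` forces total weight one. Zero values are left out: no positive threshold lies
  -- below them, so their equations are trivial.
  set s : Finset ℝ := insert 1 ((Finset.univ.image z).filter fun y => 0 < y) with hsdef
  have hs : ∀ θ ∈ s, 0 < θ ∧ θ ≤ 1 := by
    simp only [hsdef, Finset.forall_mem_insert, Finset.mem_filter, Finset.mem_image,
      Finset.mem_univ, true_and]
    refine ⟨by norm_num, ?_⟩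
    rintro _ ⟨⟨k, rfl⟩, hk⟩
    exact ⟨hk, (hz k).2⟩
  obtain ⟨w, hw, h⟩ := exists_threshold_weights s fun y hy => (hs y hy).1
  refine ⟨s, w, hs, hw, ?_, fun k => ?_⟩
  · have := h 1 (by simp [hsdef])
    rwa [Finset.sum_congr rfl fun θ hθ => by rw [if_pos (hs θ hθ).2, mul_one]] at this
  · rcases (hz k).1.lt_or_eq with hk | hk
    · exact h _ (by simp [hsdef, hk])
    · rw [← hk]
      exact Finset.sum_eq_zero fun θ hθ => by rw [if_neg (hs θ hθ).1.not_ge, mul_zero]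

/-! ### Staircase functions -/

namespace Staircase

variable {d₁ d₂ : ℕ} (π : Staircase d₁ d₂)

theorem steps_zero (a : Fin 2) : π.steps a 0 = 0 := by
  simp [steps]

theorem steps_succ (a : Fin 2) (s : Fin (d₁ + d₂)) :
    π.steps a (s.val + 1) = π.steps a s.val + if π.1 s = a then 1 else 0 := by
  have h : (Finset.univ.filter fun u : Fin (d₁ + d₂) => u.val < s.val + 1 ∧ π.1 u = a) =
      (Finset.univ.filter fun u : Fin (d₁ + d₂) => u.val < s.val ∧ π.1 u = a) ∪
        if π.1 s = a then {s} else ∅ := by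
    ext u
    split_ifs with hs
    · simp only [Finset.mem_filter, Finset.mem_univ, true_and, Finset.mem_union,
        Finset.mem_singleton, Fin.ext_iff]
      constructor
      · rintro ⟨h, h'⟩
        rcases Nat.lt_succ_iff_lt_or_eq.1 h with h | h
        · exact .inl ⟨h, h'⟩
        · exact .inr h
      · rintro (⟨h, h'⟩ | h)
        · exact ⟨h.trans (Nat.lt_succ_self _), h'⟩
        · obtain rfl : u = s := Fin.ext h
          exact ⟨Nat.lt_succ_self _, congrArg Fin.val hs⟩
    · simp only [Finset.mem_filter, Finset.mem_univ, true_and, Finset.union_empty]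
      refine and_congr_left fun h' => ⟨fun h => ?_, fun h => h.trans (Nat.lt_succ_self _)⟩
      rcases Nat.lt_succ_iff_lt_or_eq.1 h with h | h
      · exact h
      · obtain rfl : u = s := Fin.ext h
        exact absurd h' hs
  unfold steps
  rw [h, Finset.card_union_of_disjoint]
  · split_ifs <;> rfl
  · split_ifs <;> simp

theorem steps_mono (a : Fin 2) : Monotone (π.steps a) := fun _ _ h =>
  Finset.card_le_card fun _ hs => by
    simp only [Finset.mem_filter] at hs ⊢
    exact ⟨hs.1, hs.2.1.trans_le h, hs.2.2⟩

theorem steps_last_zero : π.steps 0 (d₁ + d₂) = d₁ := by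
  conv_rhs => rw [← π.2.1]
  simp [steps]

theorem steps_last_one : π.steps 1 (d₁ + d₂) = d₂ := by
  conv_rhs => rw [← π.2.2]
  simp [steps]

/-- At a point of its staircase, the affine function takes the value of the grid function. -/
theorem stairAffine_steps (ψ : ℕ → ℕ → ℝ) {t : ℕ} (ht : t ≤ d₁ + d₂) :
    stairAffine ψ π (unaryVertex d₁ (π.steps 0 t)) (unaryVertex d₂ (π.steps 1 t)) =
      ψ (π.steps 0 t) (π.steps 1 t) := by
  have h0 : π.steps 0 t ≤ d₁ := (π.steps_mono 0 ht).trans_eq π.steps_last_zero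
  have h1 : π.steps 1 t ≤ d₂ := (π.steps_mono 1 ht).trans_eq π.steps_last_one
  -- A move in direction `a` strictly raises that count, so the coordinate it reads is one exactly
  -- when the move is among the first `t`; the sum then telescopes.
  have key (a : Fin 2) (s : Fin (d₁ + d₂)) (hs : π.1 s = a) :
      π.steps a (s.val + 1) ≤ π.steps a t ↔ s.val < t := by
    constructor
    · intro h
      by_contra! hst
      have := π.steps_mono a hst
      rw [π.steps_succ, if_pos hs] at h
      omega
    · exact fun h => π.steps_mono a h
  have hc (s : Fin (d₁ + d₂)) :
      (if π.1 s = 0 then zCoord (unaryVertex d₁ (π.steps 0 t)) (π.steps 0 (s.val + 1))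
        else zCoord (unaryVertex d₂ (π.steps 1 t)) (π.steps 1 (s.val + 1))) =
      if s.val < t then (1 : ℝ) else 0 := by
    rw [zCoord_unaryVertex h0, zCoord_unaryVertex h1]
    split_ifs with hs h h' h' h h' h' <;>
      first
      | rfl
      | exact absurd ((key 0 s hs).1 h) h'
      | exact absurd ((key 0 s hs).2 h') h
      | exact absurd ((key 1 s (by omega)).1 h) h'
      | exact absurd ((key 1 s (by omega)).2 h') h
  unfold stairAffine
  simp only [hc]
  rw [Fin.sum_univ_eq_sum_range (fun s => (ψ (π.steps 0 (s + 1)) (π.steps 1 (s + 1)) -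
    ψ (π.steps 0 s) (π.steps 1 s)) * if s < t then (1 : ℝ) else 0) (d₁ + d₂)]
  have : ∑ s ∈ Finset.range (d₁ + d₂), ((ψ (π.steps 0 (s + 1)) (π.steps 1 (s + 1)) -
      ψ (π.steps 0 s) (π.steps 1 s)) * if s < t then (1 : ℝ) else 0) =
      ∑ s ∈ Finset.range t, (ψ (π.steps 0 (s + 1)) (π.steps 1 (s + 1)) -
        ψ (π.steps 0 s) (π.steps 1 s)) := by
    simp only [mul_ite, mul_one, mul_zero]
    rw [← Finset.sum_filter]
    congr 1
    ext s
    simp only [Finset.mem_filter, Finset.mem_range]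
    omega
  rw [this, Finset.sum_range_sub (fun s => ψ (π.steps 0 s) (π.steps 1 s)), steps_zero, steps_zero]
  ring

/-- For a supermodular grid function, each affine function is an upper bound at grid points. -/
theorem le_stairAffine {ψ : ℕ → ℕ → ℝ}
    (hψ : ∀ a a' b b', a ≤ a' → b ≤ b' → ψ a' b + ψ a b' ≤ ψ a b + ψ a' b')
    {a b : ℕ} (ha : a ≤ d₁) (hb : b ≤ d₂) :
    ψ a b ≤ stairAffine ψ π (unaryVertex d₁ a) (unaryVertex d₂ b) := by
  -- The staircase truncated at `(a, b)` telescopes from the origin to `(a, b)`. Its increments are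
  -- compared one by one: a move beyond the truncation contributes zero on both sides, any other
  -- move is compared by supermodularity in the other coordinate.
  set φ : ℕ → ℝ := fun s => ψ (min (π.steps 0 s) a) (min (π.steps 1 s) b) with hφ
  have htel : ψ a b = ψ 0 0 + ∑ s : Fin (d₁ + d₂), (φ (s.val + 1) - φ s.val) := by
    rw [Fin.sum_univ_eq_sum_range (fun s => φ (s + 1) - φ s), Finset.sum_range_sub]
    simp [hφ, steps_zero, steps_last_zero, steps_last_one, ha, hb]
  rw [htel]
  unfold stairAffine
  refine add_le_add_right (Finset.sum_le_sum fun s _ => ?_) _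
  simp only [hφ, steps_succ, zCoord_unaryVertex ha, zCoord_unaryVertex hb]
  set A := π.steps 0 s.val
  set B := π.steps 1 s.val
  by_cases hs : π.1 s = 0
  · simp only [hs, if_true, zero_ne_one, if_false, add_zero]
    split_ifs with h
    · rw [min_eq_left h, min_eq_left (by omega : A ≤ a)]
      have := hψ A (A + 1) (min B b) B (by omega) (min_le_left _ _)
      linarith
    · rw [min_eq_right (by omega : a ≤ A + 1), min_eq_right (by omega : a ≤ A)]
      simp
  · have hs' : π.1 s = 1 := by omega
    simp only [hs', if_true, one_ne_zero, if_false, add_zero]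
    split_ifs with h
    · rw [min_eq_left h, min_eq_left (by omega : B ≤ b)]
      have := hψ (min A a) A B (B + 1) (min_le_left _ _) (by omega)
      linarith
    · rw [min_eq_right (by omega : b ≤ B + 1), min_eq_right (by omega : b ≤ B)]
      simp

end Staircase

/-- The lattice path that raises, at each move, the argument with the larger next coordinate. -/
noncomputable def greedyPath {d₁ d₂ : ℕ} (z₁ : Fin d₁ → ℝ) (z₂ : Fin d₂ → ℝ) : ℕ → ℕ × ℕ
  | 0 => (0, 0)
  | t + 1 =>
    let q := greedyPath z₁ z₂ t
    if d₂ ≤ q.2 ∨ (q.1 < d₁ ∧ zCoord z₂ (q.2 + 1) ≤ zCoord z₁ (q.1 + 1)) then (q.1 + 1, q.2)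
    else (q.1, q.2 + 1)

theorem greedyPath_bounds {d₁ d₂ : ℕ} (z₁ : Fin d₁ → ℝ) (z₂ : Fin d₂ → ℝ) {t : ℕ}
    (ht : t ≤ d₁ + d₂) : (greedyPath z₁ z₂ t).1 + (greedyPath z₁ z₂ t).2 = t ∧
      (greedyPath z₁ z₂ t).1 ≤ d₁ ∧ (greedyPath z₁ z₂ t).2 ≤ d₂ := by
  induction t with
  | zero => simp [greedyPath]
  | succ t ih =>
    obtain ⟨h, h1, h2⟩ := ih (by omega)
    rw [greedyPath]
    split_ifs with hq
    · refine ⟨by simp only; omega, ?_, h2⟩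
      rcases hq with hq | hq <;> simp only <;> omega
    · push Not at hq
      exact ⟨by simp only; omega, h1, by simp only; omega⟩

theorem zCoord_succ {d : ℕ} (z : Fin d → ℝ) {j : ℕ} (hj : j < d) :
    zCoord z (j + 1) = z ⟨j, hj⟩ := by
  simp [zCoord, hj]

/-- Coordinates are taken in decreasing order, so those at least `θ` precede the rest. The invariant
is that the path never passes one cut while still short of the other; the number of moves then
determines the position. -/
theorem greedyPath_cut {d₁ d₂ : ℕ} {z₁ : Fin d₁ → ℝ} {z₂ : Fin d₂ → ℝ} (h₁ : Antitone z₁)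
    (h₂ : Antitone z₂) (θ : ℝ) :
    greedyPath z₁ z₂ (cut θ z₁ + cut θ z₂) = (cut θ z₁, cut θ z₂) := by
  have hc₁ := cut_le θ z₁
  have hc₂ := cut_le θ z₂
  have key (t : ℕ) (ht : t ≤ d₁ + d₂) :
      ((greedyPath z₁ z₂ t).1 ≤ cut θ z₁ ∧ (greedyPath z₁ z₂ t).2 ≤ cut θ z₂) ∨
      (cut θ z₁ ≤ (greedyPath z₁ z₂ t).1 ∧ cut θ z₂ ≤ (greedyPath z₁ z₂ t).2) := by
    induction t with
    | zero => simp [greedyPath]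
    | succ t ih =>
      obtain ⟨hsum, hb1, hb2⟩ := greedyPath_bounds z₁ z₂ (t := t) (by omega)
      have ih := ih (by omega)
      rw [greedyPath]
      set A := (greedyPath z₁ z₂ t).1
      set B := (greedyPath z₁ z₂ t).2
      split_ifs with hq
      -- The only way to break the invariant here: the greedy rule would give `θ ≤ z₂ B ≤ z₁ A`,
      -- although `A` has already reached its cut.
      · by_cases hA : A = cut θ z₁ ∧ B < cut θ z₂
        · exfalso
          have hBd : B < d₂ := by omega
          obtain ⟨hAd, hle⟩ := hq.resolve_left (by omega)
          rw [zCoord_succ _ hAd, zCoord_succ _ hBd] at hle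
          have := ((lt_cut_iff h₂ θ ⟨B, hBd⟩).1 hA.2).trans hle
          exact hA.1.not_lt ((lt_cut_iff h₁ θ ⟨A, hAd⟩).2 this)
        · simp only
          omega
      · by_cases hB : B = cut θ z₂ ∧ A < cut θ z₁
        · exfalso
          push Not at hq
          have hAd : A < d₁ := by omega
          have hle := hq.2 hAd
          rw [zCoord_succ _ hAd, zCoord_succ _ hq.1] at hle
          have := ((lt_cut_iff h₁ θ ⟨A, hAd⟩).1 hB.2).trans hle.le
          exact hB.1.not_lt ((lt_cut_iff h₂ θ ⟨B, hq.1⟩).2 this)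
        · simp only
          omega
  have hb := greedyPath_bounds z₁ z₂ (t := cut θ z₁ + cut θ z₂) (by omega)
  have hk := key (cut θ z₁ + cut θ z₂) (by omega)
  ext <;> simp only <;> omega

/-- Some staircase passes through all the pairs of cuts of two points of unary simplices. -/
theorem exists_staircase_through_cuts {d₁ d₂ : ℕ} {z₁ : Fin d₁ → ℝ} {z₂ : Fin d₂ → ℝ}
    (h₁ : Antitone z₁) (h₂ : Antitone z₂) : ∃ π : Staircase d₁ d₂, ∀ θ,
      π.steps 0 (cut θ z₁ + cut θ z₂) = cut θ z₁ ∧ π.steps 1 (cut θ z₁ + cut θ z₂) = cut θ z₂ := by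
  set g := greedyPath z₁ z₂ with hg
  set dir : Fin (d₁ + d₂) → Fin 2 := fun s => if (g (s.val + 1)).1 = (g s.val).1 then 1 else 0
    with hdir
  have hstep (t : ℕ) : (g (t + 1)).1 = (g t).1 + 1 ∧ (g (t + 1)).2 = (g t).2 ∨
      (g (t + 1)).1 = (g t).1 ∧ (g (t + 1)).2 = (g t).2 + 1 := by
    rw [hg, greedyPath]
    split_ifs <;> simp
  have hcount (t : ℕ) (ht : t ≤ d₁ + d₂) :
      (Finset.univ.filter fun s => s.val < t ∧ dir s = 0).card = (g t).1 ∧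
      (Finset.univ.filter fun s => s.val < t ∧ dir s = 1).card = (g t).2 := by
    induction t with
    | zero => simp [hg, greedyPath]
    | succ t ih =>
      have ht' : t < d₁ + d₂ := ht
      obtain ⟨ih0, ih1⟩ := ih ht'.le
      have hsucc (a : Fin 2) :
          (Finset.univ.filter fun s : Fin (d₁ + d₂) => s.val < t + 1 ∧ dir s = a).card =
          (Finset.univ.filter fun s : Fin (d₁ + d₂) => s.val < t ∧ dir s = a).card +
            if dir ⟨t, ht'⟩ = a then 1 else 0 := by
        simp only [Finset.card_filter]
        rw [← Finset.sum_erase_add _ _ (Finset.mem_univ (⟨t, ht'⟩ : Fin (d₁ + d₂))),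
          ← Finset.sum_erase_add (a := (⟨t, ht'⟩ : Fin (d₁ + d₂))) (f := fun s =>
            if s.val < t ∧ dir s = a then 1 else 0) _ (Finset.mem_univ _)]
        simp only [lt_self_iff_false, false_and, if_false, add_zero, Nat.lt_succ_self, true_and]
        congr 1
        refine Finset.sum_congr rfl fun s hs => ?_
        have : s.val ≠ t := fun h => (Finset.mem_erase.1 hs).1 (Fin.ext h)
        have : s.val < t + 1 ↔ s.val < t := by omega
        simp only [this]
      rw [hsucc, hsucc, ih0, ih1]
      rcases hstep t with ⟨h0, h1⟩ | ⟨h0, h1⟩ <;> simp [hdir, h0, h1]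
  have hlast := hcount (d₁ + d₂) le_rfl
  have hbd := greedyPath_bounds z₁ z₂ (t := d₁ + d₂) le_rfl
  rw [← hg] at hbd
  have hall : ∀ s : Fin (d₁ + d₂), (s.val < d₁ + d₂) = True := fun s => by simp
  simp only [hall, true_and] at hlast
  refine ⟨⟨dir, by omega, by omega⟩, fun θ => ?_⟩
  have ht : cut θ z₁ + cut θ z₂ ≤ d₁ + d₂ := add_le_add (cut_le _ _) (cut_le _ _)
  have hgc : g (cut θ z₁ + cut θ z₂) = (cut θ z₁, cut θ z₂) := greedyPath_cut h₁ h₂ θ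
  have := hcount _ ht
  rw [hgc] at this
  exact this

/-- Supermodularity bounds every staircase from below by `ψ a b`, and a staircase through `(a, b)`
attains it. Such a staircase comes from the cuts of the two vertices at threshold `1`. -/
theorem iInf_stairAffine_unaryVertex {d₁ d₂ : ℕ} {ψ : ℕ → ℕ → ℝ}
    (hψ : ∀ a a' b b', a ≤ a' → b ≤ b' → ψ a' b + ψ a b' ≤ ψ a b + ψ a' b')
    {a b : ℕ} (ha : a ≤ d₁) (hb : b ≤ d₂) :
    ⨅ π : Staircase d₁ d₂, stairAffine ψ π (unaryVertex d₁ a) (unaryVertex d₂ b) = ψ a b := by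
  refine le_antisymm ?_ (le_iInf_stairAffine_iff.2 fun π => π.le_stairAffine hψ ha hb)
  obtain ⟨π, hπ⟩ := exists_staircase_through_cuts (unaryVertex_mem d₁ a).2 (unaryVertex_mem d₂ b).2
  have h := hπ 1
  rw [cut_unaryVertex ha one_pos le_rfl, cut_unaryVertex hb one_pos le_rfl] at h
  refine (ciInf_le (Set.finite_range _).bddBelow π).trans_eq ?_
  have := π.stairAffine_steps ψ (t := a + b) (by omega)
  rwa [h.1, h.2] at this

/-- The difference of the two sides is the product of two nonnegative increments. -/
theorem supermodular_mul {ρ ζ : ℕ → ℝ} (hρ : Monotone ρ) (hζ : Monotone ζ) (a a' b b' : ℕ)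
    (ha : a ≤ a') (hb : b ≤ b') : ρ a' * ζ b + ρ a * ζ b' ≤ ρ a * ζ b + ρ a' * ζ b' := by
  nlinarith [mul_nonneg (sub_nonneg.2 (hρ ha)) (sub_nonneg.2 (hζ hb))]

/-- The staircase function of a product of nondecreasing factors is exact at pairs of vertices. -/
theorem stair_mul_unaryVertex {d₁ d₂ : ℕ} {ρ : (Fin d₁ → ℝ) → ℝ} {ζ : (Fin d₂ → ℝ) → ℝ}
    (hρ : Monotone fun j => ρ (unaryVertex d₁ j)) (hζ : Monotone fun j => ζ (unaryVertex d₂ j))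
    {a b : ℕ} (ha : a ≤ d₁) (hb : b ≤ d₂) :
    stair (fun y₁ y₂ => ρ y₁ * ζ y₂) (unaryVertex d₁ a) (unaryVertex d₂ b) =
      ρ (unaryVertex d₁ a) * ζ (unaryVertex d₂ b) :=
  iInf_stairAffine_unaryVertex (supermodular_mul hρ hζ) ha hb

/-- The reverse staircase function of the product of a nondecreasing and a nonincreasing factor is
exact at pairs of vertices. -/
theorem rvsStair_mul_unaryVertex {d₁ d₂ : ℕ} {ρ : (Fin d₁ → ℝ) → ℝ} {ζ : (Fin d₂ → ℝ) → ℝ}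
    (hρ : Monotone fun j => ρ (unaryVertex d₁ j)) (hζ : Antitone fun j => ζ (unaryVertex d₂ j))
    {a b : ℕ} (ha : a ≤ d₁) (hb : b ≤ d₂) :
    rvsStair (fun y₁ y₂ => ρ y₁ * ζ y₂) (unaryVertex d₁ a) (unaryVertex d₂ b) =
      ρ (unaryVertex d₁ a) * ζ (unaryVertex d₂ b) := by
  unfold rvsStair
  rw [switchInv_rev_unaryVertex hb]
  -- Truncated subtraction keeps this monotone beyond `d₂` as well.
  have hζ' : Monotone fun j => ζ (unaryVertex d₂ (d₂ - j)) := fun j k hjk =>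
    hζ (Nat.sub_le_sub_left hjk d₂)
  refine (iInf_stairAffine_unaryVertex (supermodular_mul hρ hζ') ha (Nat.sub_le _ _)).trans ?_
  simp only [Nat.sub_sub_self hb]

/-- Under a common random threshold, the staircase function is at most the expected value of the
function at the cuts. -/
theorem stair_le_sum_cut {d₁ d₂ : ℕ} (h : (Fin d₁ → ℝ) → (Fin d₂ → ℝ) → ℝ) {z₁ : Fin d₁ → ℝ}
    {z₂ : Fin d₂ → ℝ} (h₁ : Antitone z₁) (h₂ : Antitone z₂) (s : Finset ℝ) (w : ℝ → ℝ)
    (hw : ∑ θ ∈ s, w θ = 1) (hz₁ : ∑ θ ∈ s, w θ • unaryVertex d₁ (cut θ z₁) = z₁)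
    (hz₂ : ∑ θ ∈ s, w θ • unaryVertex d₂ (cut θ z₂) = z₂) :
    stair h z₁ z₂ ≤
      ∑ θ ∈ s, w θ * h (unaryVertex d₁ (cut θ z₁)) (unaryVertex d₂ (cut θ z₂)) := by
  -- The same staircase serves every threshold, so a single affine function can be averaged.
  obtain ⟨π, hπ⟩ := exists_staircase_through_cuts h₁ h₂
  refine (ciInf_le (Set.finite_range _).bddBelow π).trans_eq ?_
  set ψ : ℕ → ℕ → ℝ := fun j₁ j₂ => h (unaryVertex d₁ j₁) (unaryVertex d₂ j₂)
  have hA : IsAffineObjective fun v : (Fin d₁ → ℝ) × (Fin d₂ → ℝ) => stairAffine ψ π v.1 v.2 :=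
    isAffineObjective_stairAffine ψ π
      (fun j => .of_isLinearMap ⟨fun _ _ => rfl, fun _ _ => rfl⟩)
      (fun j => .of_isLinearMap ⟨fun _ _ => rfl, fun _ _ => rfl⟩)
  have := hA.map_sum s w hw fun θ => (unaryVertex d₁ (cut θ z₁), unaryVertex d₂ (cut θ z₂))
  simp only [Prod.fst_sum, Prod.snd_sum, Prod.smul_fst, Prod.smul_snd, hz₁, hz₂] at this
  rw [this]
  refine Finset.sum_congr rfl fun θ _ => ?_
  have hθ := π.stairAffine_steps ψ (t := cut θ z₁ + cut θ z₂)
    (add_le_add (cut_le _ _) (cut_le _ _))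
  rw [(hπ θ).1, (hπ θ).2] at hθ
  rw [hθ]

/-! ### The formulation of the price promotion problem -/

namespace PromotionModel

variable {n T M : ℕ} (D : PromotionModel n T M)

/-- A choice of ladder positions for all items and periods. -/
abbrev Plan : Type := (i : Fin n) → Fin T → Fin (D.d i + 1)

variable {D}

/-- The prices of a plan. -/
def planPrices (J : D.Plan) : Prices n T := fun i t => D.p i (J i t)

/-- The binary variables of a plan. -/
noncomputable def planBinaries (J : D.Plan) : D.BinIdx → ℝ :=
  fun q => unaryVertex (D.d q.1) (J q.1 q.2.1) q.2.2

/-- The ladder position of item `i`, `k + 1` periods before `t`. -/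
def pastPosition (J : D.Plan) (i : Fin n) (t : Fin T) (k : Fin M) : Fin (D.d i + 1) :=
  if k.val + 1 ≤ t.val then J i ⟨t.val - (k.val + 1), by omega⟩ else D.hist i (k.val - t.val)

/-- The point of the formulation that represents a plan and has the largest value. -/
noncomputable def planPoint (J : D.Plan) : D.Vars :=
  (planPrices J, planBinaries J,
    (fun i t k => (D.p i (J i t) - D.c i t) * D.h i t k (D.p i (pastPosition J i t k))),
    (fun i j t => (D.p i (J i t) - D.c i t) * D.f i j t (D.p j (J j t))))

theorem zVec_planBinaries (J : D.Plan) (i : Fin n) (t : Fin T) :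
    D.zVec (planBinaries J) i t = unaryVertex (D.d i) (J i t) := rfl

theorem zPast_planBinaries (J : D.Plan) (i : Fin n) (t : Fin T) (k : Fin M) :
    D.zPast (planBinaries J) i t k = unaryVertex (D.d i) (pastPosition J i t k) := by
  unfold zPast pastPosition
  split_ifs <;> rfl

theorem pastPrice_planPrices (J : D.Plan) (i : Fin n) (t : Fin T) (k : Fin M) :
    D.pastPrice (planPrices J) i t k = D.p i (pastPosition J i t k) := by
  unfold pastPrice pastPosition
  split_ifs <;> rfl

/-- The last coordinate is one only at the top of the ladder. A ladder with a single price is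
covered by the convention that coordinate `0` equals `1`. -/
theorem zLast_planBinaries (J : D.Plan) (i : Fin n) (t : Fin T) :
    D.zLast (planBinaries J) i t = 1 - (D.promoted (planPrices J) i t : ℝ) := by
  have hJ := (J i t).isLt
  rw [zLast, zVec_planBinaries, zCoord_unaryVertex (by omega)]
  have : D.p i (J i t) < D.p i (Fin.last _) ↔ ¬ D.d i ≤ (J i t).val := by
    rw [(D.p_strictMono i).lt_iff_lt, Fin.lt_def, Fin.val_last, not_le]
  simp only [promoted, planPrices, this]
  by_cases h : D.d i ≤ (J i t).val <;> simp [h]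

theorem satisfiesLinearRules_planBinaries_iff (B : BusinessRules n T) (J : D.Plan) :
    D.SatisfiesLinearRules B (planBinaries J) ↔ D.SatisfiesRules B (planPrices J) := by
  unfold SatisfiesLinearRules SatisfiesRules
  simp only [zLast_planBinaries, Finset.sum_sub_distrib, Finset.sum_const, Finset.card_univ,
    Fintype.card_fin, nsmul_eq_mul, mul_one, sub_le_sub_iff_left, sub_right_inj, Nat.cast_inj]
  refine and_congr (forall_congr' fun i => by exact_mod_cast Iff.rfl) <|
    and_congr (forall_congr' fun t => by exact_mod_cast Iff.rfl) <|
    and_congr Iff.rfl <| forall_congr' fun i => forall_congr' fun k => forall_congr' fun hk => ?_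
  -- The window lies inside the horizon and has `τ + 1` periods, so at most one promotion means at
  -- least `τ` regular prices.
  have hcard : (Finset.univ.filter fun t : Fin T => k ≤ t.val ∧ t.val ≤ k + B.τ i).card =
      B.τ i + 1 := by
    have : Finset.univ.filter (fun t : Fin T => k ≤ t.val ∧ t.val ≤ k + B.τ i) =
        Finset.Icc ⟨k, by omega⟩ ⟨k + B.τ i, hk⟩ := by
      ext t
      simp [Fin.le_def]
    rw [this, Fin.card_Icc]
    simp only
    omega
  rw [hcard, ← Nat.cast_sum, ← Nat.cast_le (α := ℝ)]
  push_cast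
  constructor <;> intro <;> linarith

theorem monotone_r (i : Fin n) (t : Fin T) : Monotone fun j => D.r i t (unaryVertex (D.d i) j) :=
  monotone_lift_unaryVertex (D.p_strictMono i) fun _ _ _ _ h => sub_le_sub_right h _

theorem r_unaryVertex (i : Fin n) (t : Fin T) (j : Fin (D.d i + 1)) :
    D.r i t (unaryVertex (D.d i) j) = D.p i j - D.c i t :=
  lift_unaryVertex (D.p i) (fun y => y - D.c i t) j

theorem stair_zeta_plan (hdip : D.PostPromotionDip) (J : D.Plan) (i : Fin n) (t : Fin T)
    (k : Fin M) :
    stair (fun y₁ y₂ => D.r i t y₁ * D.zeta i t k y₂) (D.zVec (planBinaries J) i t)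
      (D.zPast (planBinaries J) i t k) = (planPoint J).2.2.1 i t k := by
  rw [zPast_planBinaries, zVec_planBinaries, stair_mul_unaryVertex (ζ := D.zeta i t k)
    (monotone_r i t) (monotone_lift_unaryVertex (D.p_strictMono i) (hdip i t k)) (by omega) (by omega),
    r_unaryVertex, zeta, lift_unaryVertex]
  rfl

theorem stair_xi_plan {i : Fin n} {j : {j : Fin n // j ≠ i}} (hij : D.Substitutable i j)
    (J : D.Plan) (t : Fin T) :
    stair (fun y₁ y₂ => D.r i t y₁ * D.xi i j t y₂) (D.zVec (planBinaries J) i t)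
      (D.zVec (planBinaries J) j t) = (planPoint J).2.2.2 i j t := by
  rw [zVec_planBinaries, zVec_planBinaries, stair_mul_unaryVertex (ζ := D.xi i j t)
    (monotone_r i t) (monotone_lift_unaryVertex (D.p_strictMono j) (hij t).1) (by omega) (by omega),
    r_unaryVertex, xi, lift_unaryVertex]
  rfl

theorem rvsStair_xi_plan {i : Fin n} {j : {j : Fin n // j ≠ i}} (hij : D.Complementary i j)
    (J : D.Plan) (t : Fin T) :
    rvsStair (fun y₁ y₂ => D.r i t y₁ * D.xi i j t y₂) (D.zVec (planBinaries J) i t)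
      (D.zVec (planBinaries J) j t) = (planPoint J).2.2.2 i j t := by
  rw [zVec_planBinaries, zVec_planBinaries, rvsStair_mul_unaryVertex (ζ := D.xi i j t)
    (monotone_r i t) (antitone_lift_unaryVertex (D.p_strictMono j) (hij t).1) (by omega) (by omega),
    r_unaryVertex, xi, lift_unaryVertex]
  rfl

theorem planPoint_mem (hdip : D.PostPromotionDip) {rules : Option (BusinessRules n T)} {J : D.Plan}
    (hJ : ∀ B ∈ rules, D.SatisfiesRules B (planPrices J)) : planPoint J ∈ D.lpRegion rules := by
  refine ⟨fun i t k => (stair_zeta_plan hdip J i t k).ge,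
    fun i t j hij => (stair_xi_plan hij J t).ge, fun i t j hij => (rvsStair_xi_plan hij J t).ge,
    fun i t => ⟨?_, unaryVertex_mem (D.d i) (J i t)⟩,
    fun B hB => (satisfiesLinearRules_planBinaries_iff B J).2 (hJ B hB)⟩
  exact (lift_unaryVertex (D.p i) id (J i t)).symm

/-- The point of a plan is the largest point of the region with its binary variables. -/
theorem le_planPoint (hdip : D.PostPromotionDip)
    (hpair : ∀ i j : Fin n, i ≠ j → D.Substitutable i j ∨ D.Complementary i j)
    {rules : Option (BusinessRules n T)} {v : D.Vars} (hv : v ∈ D.lpRegion rules) {J : D.Plan}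
    (hz : v.2.1 = planBinaries J) : v.1 = planPrices J ∧ v.2.2 ≤ (planPoint J).2.2 := by
  obtain ⟨x, z, μ, ν⟩ := v
  obtain rfl : z = planBinaries J := hz
  obtain ⟨hμ, hS, hC, hb, -⟩ := hv
  refine ⟨funext fun i => funext fun t => (hb i t).1.trans (lift_unaryVertex (D.p i) id (J i t)),
    fun i t k => (hμ i t k).trans_eq (stair_zeta_plan hdip J i t k), fun i j t => ?_⟩
  -- Each `ν` is bounded by at least one kind of staircase constraint, and both kinds give the same
  -- value at vertices.
  rcases hpair i j j.2.symm with hij | hij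
  · exact (hS i t j hij).trans_eq (stair_xi_plan hij J t)
  · exact (hC i t j hij).trans_eq (rvsStair_xi_plan hij J t)

theorem objective_planPoint (J : D.Plan) : D.objective (planPoint J) = D.profit (planPrices J) := by
  unfold objective profit
  refine Finset.sum_congr rfl fun i _ => Finset.sum_congr rfl fun t _ => ?_
  have hl : D.ell i t (D.zVec (planPoint J).2.1 i t) =
      (D.p i (J i t) - D.c i t) * D.f i i t (D.p i (J i t)) :=
    lift_unaryVertex (D.p i) (fun y => (y - D.c i t) * D.f i i t y) (J i t)
  rw [hl, demand, Fintype.sum_eq_add_sum_subtype_ne _ i]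
  simp only [planPoint, pastPrice_planPrices, mul_add, Finset.mul_sum]
  simp only [planPrices]
  ring

/-! ### Comparison of points with the same `z` -/

theorem objective_sub {v w : D.Vars} (hz : v.2.1 = w.2.1) :
    D.objective w - D.objective v = ∑ i, ∑ t, (∑ k, (w.2.2.1 i t k - v.2.2.1 i t k) +
      ∑ j : {j : Fin n // j ≠ i}, (w.2.2.2 i j t - v.2.2.2 i j t)) := by
  simp only [objective, hz, ← Finset.sum_sub_distrib]
  refine Finset.sum_congr rfl fun i _ => Finset.sum_congr rfl fun t _ => ?_
  simp only [Finset.sum_sub_distrib]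
  ring

theorem objective_mono {v w : D.Vars} (hz : v.2.1 = w.2.1) (h : v.2.2 ≤ w.2.2) :
    D.objective v ≤ D.objective w := by
  rw [← sub_nonneg, objective_sub hz]
  exact Finset.sum_nonneg fun i _ => Finset.sum_nonneg fun t _ => add_nonneg
    (Finset.sum_nonneg fun k _ => sub_nonneg.2 (h.1 i t k))
    (Finset.sum_nonneg fun j _ => sub_nonneg.2 (h.2 i j t))

/-- Every auxiliary variable has coefficient one in the objective, so a gap in any of them would
show in the value. -/
theorem eq_of_objective_eq {v w : D.Vars} (hz : v.2.1 = w.2.1) (h : v.2.2 ≤ w.2.2)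
    (hobj : D.objective v = D.objective w) : v.2.2 = w.2.2 := by
  have h0 := objective_sub hz
  have hμ (i : Fin n) (t : Fin T) : ∀ k ∈ Finset.univ, 0 ≤ w.2.2.1 i t k - v.2.2.1 i t k :=
    fun k _ => sub_nonneg.2 (h.1 i t k)
  have hν (i : Fin n) (t : Fin T) :
      ∀ j ∈ Finset.univ (α := {j : Fin n // j ≠ i}), 0 ≤ w.2.2.2 i j t - v.2.2.2 i j t :=
    fun j _ => sub_nonneg.2 (h.2 i j t)
  have hit (i : Fin n) (t : Fin T) := add_nonneg (Finset.sum_nonneg (hμ i t))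
    (Finset.sum_nonneg (hν i t))
  rw [hobj, sub_self, eq_comm,
    Finset.sum_eq_zero_iff_of_nonneg fun i _ => Finset.sum_nonneg fun t _ => hit i t] at h0
  have h1 (i : Fin n) (t : Fin T) := (add_eq_zero_iff_of_nonneg (Finset.sum_nonneg (hμ i t))
    (Finset.sum_nonneg (hν i t))).1 <| (Finset.sum_eq_zero_iff_of_nonneg fun t _ => hit i t).1
      (h0 i (Finset.mem_univ i)) t (Finset.mem_univ t)
  refine Prod.ext (funext fun i => funext fun t => funext fun k => ?_)
    (funext fun i => funext fun j => funext fun t => ?_)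
  · exact (sub_eq_zero.1 ((Finset.sum_eq_zero_iff_of_nonneg (hμ i t)).1 (h1 i t).1 k
      (Finset.mem_univ k))).symm
  · exact (sub_eq_zero.1 ((Finset.sum_eq_zero_iff_of_nonneg (hν i t)).1 (h1 i t).2 j
      (Finset.mem_univ j))).symm

theorem exists_planPrices_eq {rules : Option (BusinessRules n T)} {x : Prices n T}
    (hx : x ∈ D.feasible rules) : ∃ J : D.Plan, planPrices J = x := by
  choose J hJ using hx.1
  exact ⟨J, funext fun i => funext fun t => hJ i t⟩

theorem planPrices_mem_feasible {rules : Option (BusinessRules n T)} {J : D.Plan}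
    (hJ : ∀ B ∈ rules, D.SatisfiesRules B (planPrices J)) : planPrices J ∈ D.feasible rules :=
  ⟨fun i t => ⟨J i t, rfl⟩, hJ⟩

/-! ### Polyhedrality of the region and linearity of the objective -/

theorem isAffineObjective_zVec (i : Fin n) (t : Fin T) (j : Fin (D.d i)) :
    IsAffineObjective fun v : D.Vars => D.zVec v.2.1 i t j :=
  .of_isLinearMap ⟨fun _ _ => rfl, fun _ _ => rfl⟩

theorem isAffineObjective_zPast (i : Fin n) (t : Fin T) (k : Fin M) (j : Fin (D.d i)) :
    IsAffineObjective fun v : D.Vars => D.zPast v.2.1 i t k j := by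
  unfold zPast
  split_ifs
  · exact isAffineObjective_zVec _ _ _
  · exact .const _

theorem isAffineObjective_zLast (i : Fin n) (t : Fin T) :
    IsAffineObjective fun v : D.Vars => D.zLast v.2.1 i t :=
  isAffineObjective_zCoord (isAffineObjective_zVec i t) _

theorem isAffineObjective_objective : IsAffineObjective D.objective :=
  .sum _ fun i => .sum _ fun t =>
    ((isAffineObjective_lift _ _ (isAffineObjective_zVec i t)).add
      (.sum _ fun _ => .of_isLinearMap ⟨fun _ _ => rfl, fun _ _ => rfl⟩)).add
      (.sum _ fun _ => .of_isLinearMap ⟨fun _ _ => rfl, fun _ _ => rfl⟩)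

theorem isPolyhedron_satisfiesLinearRules (B : BusinessRules n T) :
    IsPolyhedron {v : D.Vars | D.SatisfiesLinearRules B v.2.1} := by
  refine .and (.forall fun i => ?_) <| .and (.forall fun t => ?_) <|
    .and (.forall fun t => .forall fun i => .imp fun _ => .forall fun j => .imp fun _ => ?_) ?_
  · exact (IsAffineObjective.const _).isPolyhedron_le (.sum _ fun t => isAffineObjective_zLast i t)
  · exact (IsAffineObjective.const _).isPolyhedron_le (.sum _ fun i => isAffineObjective_zLast i t)
  · exact (isAffineObjective_zLast i t).isPolyhedron_eq (isAffineObjective_zLast j t)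
  -- Only window starts below `T` matter, which leaves a finite family of inequalities.
  · have (v : D.Vars) : (∀ i, ∀ k : ℕ, k + B.τ i < T → (B.τ i : ℝ) ≤
        ∑ t : Fin T with k ≤ t.val ∧ t.val ≤ k + B.τ i, D.zLast v.2.1 i t) ↔
        ∀ i, ∀ k : Fin T, k.val + B.τ i < T → (B.τ i : ℝ) ≤
          ∑ t : Fin T with k.val ≤ t.val ∧ t.val ≤ k.val + B.τ i, D.zLast v.2.1 i t :=
      forall_congr' fun i => ⟨fun h k => h k, fun h k hk => h ⟨k, by omega⟩ hk⟩
    simp only [this]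
    exact .forall fun i => .forall fun k => .imp fun _ =>
      (IsAffineObjective.const _).isPolyhedron_le (.sum _ fun t => isAffineObjective_zLast i t)

theorem isPolyhedron_lpRegion (rules : Option (BusinessRules n T)) :
    IsPolyhedron (D.lpRegion rules) := by
  refine .and (.forall fun i => .forall fun t => .forall fun k => ?_) <|
    .and (.forall fun i => .forall fun t => .forall fun j => .imp fun _ => ?_) <|
    .and (.forall fun i => .forall fun t => .forall fun j => .imp fun _ => ?_) <|
    .and (.forall fun i => .forall fun t => .and ?_ ?_) ?_
  · exact isPolyhedron_le_stair _ (.of_isLinearMap ⟨fun _ _ => rfl, fun _ _ => rfl⟩)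
      (isAffineObjective_zVec i t) (isAffineObjective_zPast i t k)
  · exact isPolyhedron_le_stair _ (.of_isLinearMap ⟨fun _ _ => rfl, fun _ _ => rfl⟩)
      (isAffineObjective_zVec i t) (isAffineObjective_zVec (j : Fin n) t)
  · exact isPolyhedron_le_rvsStair _ (.of_isLinearMap ⟨fun _ _ => rfl, fun _ _ => rfl⟩)
      (isAffineObjective_zVec i t) (isAffineObjective_zVec (j : Fin n) t)
  · exact IsAffineObjective.isPolyhedron_eq (.of_isLinearMap ⟨fun _ _ => rfl, fun _ _ => rfl⟩)
      (isAffineObjective_lift (D.p i) id (isAffineObjective_zVec i t))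
  · exact isPolyhedron_mem_unarySimplex (isAffineObjective_zVec i t)
  · cases rules with
    | none => simpa using IsPolyhedron.true
    | some B => simpa using isPolyhedron_satisfiesLinearRules B

/-! ### Binary points and the mixed-integer formulation -/

theorem exists_plan_of_binary {rules : Option (BusinessRules n T)} {v : D.Vars}
    (hv : v ∈ binaryPoints (D.lpRegion rules)) : ∃ J : D.Plan, v.2.1 = planBinaries J := by
  obtain ⟨⟨-, -, -, hb, -⟩, h01⟩ := hv
  refine ⟨fun i t => ⟨cut 1 (D.zVec v.2.1 i t), Nat.lt_succ_of_le (cut_le _ _)⟩, ?_⟩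
  funext ⟨i, t, k⟩
  refine Eq.trans ?_ (unaryVertex_cut (hb i t).2.2 1 k).symm
  change v.2.1 ⟨i, t, k⟩ = if 1 ≤ v.2.1 ⟨i, t, k⟩ then 1 else 0
  rcases h01 ⟨i, t, k⟩ with h | h <;> simp [h]

theorem isMIPFormulation (hdip : D.PostPromotionDip)
    (hpair : ∀ i j : Fin n, i ≠ j → D.Substitutable i j ∨ D.Complementary i j)
    (rules : Option (BusinessRules n T)) :
    IsMIPFormulation (D.feasible rules) D.profit (D.lpRegion rules) D.objective := by
  refine ⟨isPolyhedron_lpRegion rules, isAffineObjective_objective, Set.ext ?_⟩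
  rintro ⟨x, w⟩
  constructor
  · rintro ⟨v, hv, rfl, hw⟩
    obtain ⟨J, hJ⟩ := exists_plan_of_binary hv
    obtain ⟨hx, hle⟩ := le_planPoint hdip hpair hv.1 hJ
    change w ≤ D.objective v at hw
    change v.1 ∈ D.feasible rules ∧ w ≤ D.profit v.1
    rw [hx]
    refine ⟨planPrices_mem_feasible fun B hB => ?_, ?_⟩
    · rw [← satisfiesLinearRules_planBinaries_iff, ← hJ]
      exact hv.1.2.2.2.2 B hB
    · rw [← objective_planPoint]
      exact hw.trans (objective_mono hJ hle)
  · rintro ⟨hx, hw⟩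
    obtain ⟨J, rfl⟩ := exists_planPrices_eq hx
    refine ⟨planPoint J, ⟨planPoint_mem hdip hx.2, fun k => ?_⟩, rfl, ?_⟩
    · change unaryVertex _ _ _ = _ ∨ unaryVertex _ _ _ = _
      unfold unaryVertex
      split_ifs <;> simp
    · exact hw.trans_eq (objective_planPoint J).symm

/-- The point of a plan is a vertex of the relaxation. -/
theorem planPoint_mem_extremePoints (hdip : D.PostPromotionDip)
    (hpair : ∀ i j : Fin n, i ≠ j → D.Substitutable i j ∨ D.Complementary i j) (J : D.Plan) :
    planPoint J ∈ (D.lpRegion none).extremePoints ℝ := by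
  have hz01 {v : D.Vars} (hv : v ∈ D.lpRegion none) (q : D.BinIdx) : 0 ≤ v.2.1 q ∧ v.2.1 q ≤ 1 :=
    (hv.2.2.2.1 q.1 q.2.1).2.1 q.2.2
  refine ⟨planPoint_mem hdip (by simp), ?_⟩
  rintro v hv w hw ⟨a, b, ha, hb, hab, h⟩
  have hzq (q : D.BinIdx) : a * v.2.1 q + b * w.2.1 q = planBinaries J q :=
    congrArg (fun u : D.Vars => u.2.1 q) h
  have hpq (q : D.BinIdx) : planBinaries J q = 0 ∨ planBinaries J q = 1 := by
    unfold planBinaries unaryVertex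
    split_ifs <;> simp
  -- Zero and one are extreme in `[0, 1]`, so both endpoints of the segment have the binaries of
  -- `J`. Their auxiliary variables then lie below those of the plan point and average to them,
  -- which forces equality.
  have hboth : v.2.1 = planBinaries J ∧ w.2.1 = planBinaries J := by
    constructor <;> funext q <;> rcases hpq q with h0 | h0 <;>
      have h1 := hzq q <;> have hv1 := hz01 hv q <;> have hw1 := hz01 hw q <;>
      rw [h0] at h1 ⊢ <;> obtain rfl : b = 1 - a := by linarith
    all_goals nlinarith [mul_nonneg ha.le hv1.1, mul_nonneg hb.le hw1.1,
      mul_nonneg ha.le (sub_nonneg.2 hv1.2), mul_nonneg hb.le (sub_nonneg.2 hw1.2)]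
  obtain ⟨hvx, hvy⟩ := le_planPoint hdip hpair hv hboth.1
  obtain ⟨-, hwy⟩ := le_planPoint hdip hpair hw hboth.2
  have hy : a • v.2.2 + b • w.2.2 = (planPoint J).2.2 := congrArg (fun u : D.Vars => u.2.2) h
  have key {α β p : ℝ} (hα : α ≤ p) (hβ : β ≤ p) (hp : a * α + b * β = p) : α = p := by
    obtain rfl : b = 1 - a := by linarith
    nlinarith
  refine Prod.ext hvx (Prod.ext hboth.1 (Prod.ext ?_ ?_))
  · funext i t k
    exact key (hvy.1 i t k) (hwy.1 i t k) (congrArg (fun u : Aux n T M => u.1 i t k) hy)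
  · funext i j t
    exact key (hvy.2 i j t) (hwy.2 i j t) (congrArg (fun u : Aux n T M => u.2 i j t) hy)

/-- If all items are substitutable, each point of the relaxation is dominated by a convex
combination of plans. -/
theorem exists_mem_convexHull_planPoint (hsub : ∀ i j : Fin n, i ≠ j → D.Substitutable i j)
    {v : D.Vars} (hv : v ∈ D.lpRegion none) :
    ∃ w ∈ convexHull ℝ (Set.range (planPoint (D := D))),
      v.1 = w.1 ∧ v.2.1 = w.2.1 ∧ v.2.2 ≤ w.2.2 := by
  obtain ⟨hμ, hS, -, hb, -⟩ := hv
  -- One threshold distribution for all items and periods together; this makes the bounds for all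
  -- pairs hold for one and the same mixture of plans.
  obtain ⟨s, wt, hs, hw0, hw1, hwz⟩ := exists_random_threshold v.2.1
    fun q => (hb q.1 q.2.1).2.1 q.2.2
  set J : ℝ → D.Plan := fun θ i t => ⟨cut θ (D.zVec v.2.1 i t), Nat.lt_succ_of_le (cut_le _ _)⟩
  have hz (i : Fin n) (t : Fin T) :
      ∑ θ ∈ s, wt θ • unaryVertex (D.d i) (cut θ (D.zVec v.2.1 i t)) = D.zVec v.2.1 i t := by
    funext k
    simp only [Finset.sum_apply, Pi.smul_apply, unaryVertex_cut (hb i t).2.2, smul_eq_mul]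
    exact hwz ⟨i, t, k⟩
  have hpast (i : Fin n) (t : Fin T) (k : Fin M) : Antitone (D.zPast v.2.1 i t k) ∧
      (∑ θ ∈ s, wt θ • unaryVertex (D.d i) (cut θ (D.zPast v.2.1 i t k)) =
        D.zPast v.2.1 i t k) ∧
      ∀ θ ∈ s, cut θ (D.zPast v.2.1 i t k) = pastPosition (J θ) i t k := by
    unfold zPast pastPosition
    split_ifs with hkt
    · exact ⟨(hb i _).2.2, hz i _, fun _ _ => rfl⟩
    -- Thresholds lie in `(0, 1]`, so cutting a given historical vertex returns its own position.
    · have hc : ∀ θ ∈ s, cut θ (unaryVertex (D.d i) (D.hist i (k.val - t.val))) =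
          (D.hist i (k.val - t.val)).val :=
        fun θ hθ => cut_unaryVertex (by omega) (hs θ hθ).1 (hs θ hθ).2
      refine ⟨(unaryVertex_mem _ _).2, ?_, hc⟩
      rw [Finset.sum_congr rfl fun θ hθ => by rw [hc θ hθ], ← Finset.sum_smul, hw1, one_smul]
  refine ⟨∑ θ ∈ s, wt θ • planPoint (J θ), (convex_convexHull ℝ _).sum_mem hw0 hw1
    fun θ _ => subset_convexHull ℝ _ ⟨J θ, rfl⟩, ?_, ?_, ?_, ?_⟩
  · funext i t
    have hA : IsAffineObjective fun z : Fin (D.d i) → ℝ => lift (D.p i) id z :=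
      isAffineObjective_lift _ _ fun j => .of_isLinearMap ⟨fun _ _ => rfl, fun _ _ => rfl⟩
    have := hA.map_sum s wt hw1 fun θ => unaryVertex (D.d i) (J θ i t)
    simp only [lift_unaryVertex, id] at this
    simp only [Prod.fst_sum, Prod.smul_fst, Finset.sum_apply, Pi.smul_apply, smul_eq_mul]
    refine Eq.trans ?_ this
    rw [hz i t]
    exact (hb i t).1
  · funext ⟨i, t, k⟩
    simp only [Prod.fst_sum, Prod.snd_sum, Prod.smul_fst, Prod.smul_snd]
    have := congrFun (hz i t) k
    simp only [Finset.sum_apply] at this ⊢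
    exact this.symm
  · intro i t k
    simp only [Prod.fst_sum, Prod.snd_sum, Prod.smul_fst, Prod.smul_snd, Finset.sum_apply,
      Pi.smul_apply, smul_eq_mul]
    obtain ⟨hp1, hp2, hp3⟩ := hpast i t k
    refine (hμ i t k).trans ((stair_le_sum_cut _ (hb i t).2.2 hp1 s wt hw1 (hz i t) hp2).trans_eq
      (Finset.sum_congr rfl fun θ hθ => ?_))
    rw [hp3 θ hθ, zeta, lift_unaryVertex]
    exact congrArg (fun y => wt θ * (y * _)) (r_unaryVertex i t (J θ i t))
  · intro i j t
    simp only [Prod.snd_sum, Prod.smul_snd, Finset.sum_apply,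
      Pi.smul_apply, smul_eq_mul]
    refine (hS i t j (hsub i j j.2.symm)).trans ((stair_le_sum_cut _ (hb i t).2.2 (hb j t).2.2 s wt
      hw1 (hz i t) (hz j t)).trans_eq (Finset.sum_congr rfl fun θ hθ => ?_))
    have h1 := r_unaryVertex i t (J θ i t)
    have h2 := lift_unaryVertex (D.p j) (D.f i j t) (J θ j t)
    exact congrArg (wt θ * ·) (congrArg₂ (· * ·) h1 h2)

/-! ### Optimal values and optimal vertices of the relaxation -/

theorem convex_lpRegion (rules : Option (BusinessRules n T)) : Convex ℝ (D.lpRegion rules) := by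
  obtain ⟨m, a, b, h⟩ := isPolyhedron_lpRegion (D := D) rules
  rw [h, Set.ofPred_forall]
  exact convex_iInter fun k => convex_halfSpace_le (a k).isLinear (b k)

theorem objective_le_of_mem_convexHull {A : Set D.Vars} {w : ℝ} (hA : ∀ v ∈ A, D.objective v ≤ w)
    {v : D.Vars} (hv : v ∈ convexHull ℝ A) : D.objective v ≤ w := by
  obtain ⟨a, b, h⟩ := isAffineObjective_objective (D := D)
  have hc : Convex ℝ {v : D.Vars | a v ≤ w - b} := convex_halfSpace_le a.isLinear _
  have := convexHull_min (fun u hu => by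
    have := hA u hu
    rw [h] at this
    exact le_sub_iff_add_le.2 this) hc hv
  rw [h]
  exact le_sub_iff_add_le.1 this

theorem lpSolves (hdip : D.PostPromotionDip)
    (hsub : ∀ i j : Fin n, i ≠ j → D.Substitutable i j) :
    LPSolves (D.feasible none) D.profit (D.lpRegion none) D.objective := by
  have hpair : ∀ i j : Fin n, i ≠ j → D.Substitutable i j ∨ D.Complementary i j :=
    fun i j hij => .inl (hsub i j hij)
  have hfeas (J : D.Plan) : planPrices J ∈ D.feasible none := planPrices_mem_feasible (by simp)
  have hmem (J : D.Plan) : planPoint J ∈ D.lpRegion none := planPoint_mem hdip (by simp)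
  obtain ⟨Jmax, hmax⟩ := Finite.exists_max fun J : D.Plan => D.profit (planPrices J)
  have hS : IsGreatest (D.profit '' D.feasible none) (D.profit (planPrices Jmax)) := by
    refine ⟨⟨_, hfeas Jmax, rfl⟩, ?_⟩
    rintro _ ⟨x, hx, rfl⟩
    obtain ⟨J, rfl⟩ := exists_planPrices_eq hx
    exact hmax J
  have hhull {v : D.Vars} (hv : v ∈ convexHull ℝ (Set.range (planPoint (D := D)))) :
      D.objective v ≤ D.profit (planPrices Jmax) := by
    refine objective_le_of_mem_convexHull ?_ hv
    rintro _ ⟨J, rfl⟩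
    exact (objective_planPoint J).trans_le (hmax J)
  have hQ : IsGreatest (D.objective '' D.lpRegion none) (D.profit (planPrices Jmax)) := by
    refine ⟨⟨_, hmem Jmax, objective_planPoint Jmax⟩, ?_⟩
    rintro _ ⟨v, hv, rfl⟩
    obtain ⟨w, hw, -, hz, hle⟩ := exists_mem_convexHull_planPoint hsub hv
    exact (objective_mono hz hle).trans (hhull hw)
  refine ⟨isPolyhedron_lpRegion none, isAffineObjective_objective, ⟨_, hS, hQ⟩, Set.ext fun x => ?_⟩
  constructor
  · rintro ⟨hx, hxmax⟩
    obtain ⟨J, rfl⟩ := exists_planPrices_eq hx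
    refine ⟨planPoint J, ⟨⟨hmem J, fun v hv => ?_⟩, planPoint_mem_extremePoints hdip hpair J⟩, rfl⟩
    change D.objective v ≤ D.objective (planPoint J)
    rw [objective_planPoint]
    exact (hQ.2 ⟨v, hv, rfl⟩).trans (hxmax (hfeas Jmax))
  · rintro ⟨v, ⟨⟨hv, hvmax⟩, hext⟩, rfl⟩
    obtain ⟨w, hw, hx, hz, hle⟩ := exists_mem_convexHull_planPoint hsub hv
    have hobj : D.objective v = D.objective w := (objective_mono hz hle).antisymm <|
      (hhull hw).trans <| (objective_planPoint Jmax).symm.trans_le (hvmax (hmem Jmax))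
    -- Optimality leaves no slack between `v` and its dominating point, so `v` itself lies in the
    -- convex hull of the plan points.
    obtain rfl : v = w := Prod.ext hx (Prod.ext hz (eq_of_objective_eq hz hle hobj))
    have hsubset : convexHull ℝ (Set.range (planPoint (D := D))) ⊆ D.lpRegion none :=
      convexHull_min (Set.range_subset_iff.2 hmem) (convex_lpRegion none)
    -- A vertex of the region lying in the smaller hull is extreme there too, hence is one of the
    -- generating plan points.
    obtain ⟨J, rfl⟩ := extremePoints_convexHull_subset
      (inter_extremePoints_subset_extremePoints_of_subset hsubset ⟨hw, hext⟩)
    refine ⟨hfeas J, fun y hy => ?_⟩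
    change D.profit y ≤ D.profit (planPrices J)
    rw [← objective_planPoint]
    exact (hS.2 ⟨y, hy, rfl⟩).trans <|
      (objective_planPoint Jmax).symm.trans_le (hvmax (hmem Jmax))

end PromotionModel

theorem corollary3 {n T M : ℕ} (D : PromotionModel n T M) (hdip : D.PostPromotionDip)
    (hpair : ∀ i j : Fin n, i ≠ j → D.Substitutable i j ∨ D.Complementary i j) :
    (∀ rules : Option (BusinessRules n T),
      IsMIPFormulation (D.feasible rules) D.profit (D.lpRegion rules) D.objective) ∧
    ((∀ i j : Fin n, i ≠ j → D.Substitutable i j) →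
      LPSolves (D.feasible none) D.profit (D.lpRegion none) D.objective) :=
  ⟨PromotionModel.isMIPFormulation hdip hpair, PromotionModel.lpSolves hdip⟩
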